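/- Fix $t\in\mathbb N$. A coloured graph is a simple graph with $t$ distinguished sets of vertices (the colours; $t=0$ gives plain graphs). It is viewed as a structure with a binary adjacency predicate and $t$ unary predicates, and formulas are first-order formulas over this signature. A graph $H$ is an $r$-shallow topological minor of $G$ if some graph obtained from $H$ by replacing each edge $uv$ by a path with ends $u,v$ and at most $r$ internal vertices is a subgraph of $G$. For a class $\mathcal C$ of coloured graphs, let $\mathrm{TopMinors}_r(\mathcal C)$ be the class of $r$-shallow topological minors of the graphs underlying members of $\mathcal C$. Trees are finite and rooted, and the depth of a tree is the maximal number of vertices on a root-to-leaf path. The tree rank of $\mathcal C$ is the largest $d\in\mathbb N$ such that for some $r\in\mathbb N$ all trees of depth $d$ belong to $\mathrm{TopMinors}_r(\mathcal C)$, if there is a largest one. Let $\mathsf{tower}(0,n)=n$ and $\mathsf{tower}(h+1,n)=2^{\mathsf{tower}(h,n)}$; a function $f\colon\mathbb N\to\mathbb N$ is elementarily bounded if for some $h$ we have $f(n)\le\mathsf{tower}(h,n)$ for all $n$. The elementary tree rank of $\mathcal C$ is the least $d\in\mathbb N$ (if any) for which there is an elementarily bounded $f$ such that for every $r\in\mathbb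 N$ some tree of depth $d+1$ with exactly $f(r)$ vertices is not in $\mathrm{TopMinors}_r(\mathcal C)$. The alternation rank of a formula is the maximum, over all branches of the syntax tree of its negation normal form, of the number of alternations (consecutive $\exists\forall$ or $\forall\exists$) in the word of quantifiers along the branch. The size $|\varphi|$ is the number of symbols of $\varphi$. Two formulas $\varphi(\bar x),\psi(\bar x)$ are equivalent on $\mathcal C$ if $G\models\varphi(\bar a)\Leftrightarrow G\models\psi(\bar a)$ for all $G\in\mathcal C$ and all tuples $\bar a$ of vertices of $G$. Theorem. Let $\mathcal C$ be a class of coloured graphs and let $d\in\mathbb N$. (1) If $\mathcal C$ has tree rank $d$, then every formula $\varphi(\bar x)$ is equivalent on $\mathcal C$ to a formula $\psi(\bar x)$ of alternation rank at most $3d-1$. (2) If $\mathcal C$ has elementary tree rank $d$, then there is an elementarily bounded function $f\colon\mathbb N\to\mathbb N$ such that every formula $\varphi(\bar x)$ is equivalent on $\mathcal C$ to a formula $\psi(\bar x)$ of alternation rank at most $3d-1$ and of size $|\psi|\le f(|\varphi|)$. (In the degenerate case $d=0$, where $\mathcal C$ contains no graph with a vertex, the bound $3d-1$ is read as $0$.)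 -/

import Mathlib

open FirstOrder

universe u v

/-! ### Shallow topological minors, rooted trees -/

/-- `H` is an `r`-shallow topological minor of `G`: some `≤ r`-subdivision of `H` is a subgraph
of `G`. The vertices of `H` go to distinct vertices of `G`, and each edge of `H` goes to a path of
`G` between the images of its ends with at most `r` internal vertices (so of length at most
`r + 1`); no path has an image of a vertex of `H` in its interior, and the paths of distinct edges
have disjoint interiors. (An edge is listed in both orientations `(u, v)`, `(v, u)`; no relation
between the two paths is needed, since either one alone serves.) -/
def IsShallowTopMinor {W : Type u} {V : Type v} (r : ℕ) (H : SimpleGraph W)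
    (G : SimpleGraph V) : Prop :=
  ∃ (f : W ↪ V) (P : ∀ a b : W, H.Adj a b → G.Walk (f a) (f b)),
    (∀ a b (h : H.Adj a b), (P a b h).IsPath ∧ (P a b h).length ≤ r + 1) ∧
    (∀ a b (h : H.Adj a b) (w : W), f w ∈ (P a b h).support → w = a ∨ w = b) ∧
    (∀ a b (h : H.Adj a b) a' b' (h' : H.Adj a' b'), s(a, b) ≠ s(a', b') →
      ∀ x ∈ (P a b h).support, x ∈ (P a' b' h').support → x ∈ Set.range f)

/-- `T`, rooted at `root`, is a tree of depth `d`; the depth is the largest number of vertices on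
a path that starts at the root (the path to `x` has `T.dist root x + 1` vertices, and a longest
one ends in a leaf). -/
def IsRootedTreeOfDepth {W : Type u} (T : SimpleGraph W) (root : W) (d : ℕ) : Prop :=
  T.IsTree ∧ IsGreatest (Set.range fun x => T.dist root x + 1) d

/-! ### Coloured graphs -/

/-- A simple graph with `t` colours, each a set of vertices; `t = 0` gives plain graphs. -/
structure ColoredGraph (t : ℕ) where
  /-- the vertex set -/
  V : Type u
  /-- the underlying graph -/
  graph : SimpleGraph V
  /-- the colours -/
  color : Fin t → Set V

/-- `H` is an `r`-shallow topological minor of (the graph underlying) some member of `C`. -/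
def InTopMinors {t : ℕ} (C : Set (ColoredGraph.{u} t)) (r : ℕ) {W : Type v}
    (H : SimpleGraph W) : Prop :=
  ∃ G ∈ C, IsShallowTopMinor r H G.graph

/-! ### Tree rank and elementary tree rank -/

/-- The class `C` has tree rank `d`: `d` is the largest number such that, for some `r`, all finite
rooted trees of depth `d` are `r`-shallow topological minors of members of `C`. -/
def HasTreeRank {t : ℕ} (C : Set (ColoredGraph.{u} t)) (d : ℕ) : Prop :=
  IsGreatest {e : ℕ | ∃ r : ℕ, ∀ (W : Type) [Finite W] (T : SimpleGraph W) (root : W),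
    IsRootedTreeOfDepth T root e → InTopMinors C r T} d

/-- `tower h n = 2 ^ (2 ^ (⋯ ^ (2 ^ n)))`, with `h` twos. -/
def tower : ℕ → ℕ → ℕ
  | 0, n => n
  | h + 1, n => 2 ^ tower h n

/-- `f` is bounded by an elementary function. -/
def ElementarilyBounded (f : ℕ → ℕ) : Prop :=
  ∃ h : ℕ, ∀ n : ℕ, f n ≤ tower h n

/-- The class `C` has elementary tree rank `d`: `d` is the least number such that, for some
elementarily bounded `f` and all `r`, some rooted tree of depth `d + 1` with `f r` vertices is not
an `r`-shallow topological minor of any member of `C`. -/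
def HasElementaryTreeRank {t : ℕ} (C : Set (ColoredGraph.{u} t)) (d : ℕ) : Prop :=
  IsLeast {e : ℕ | ∃ f : ℕ → ℕ, ElementarilyBounded f ∧ ∀ r : ℕ,
    ∃ (W : Type) (_ : Finite W) (T : SimpleGraph W) (root : W),
      IsRootedTreeOfDepth T root (e + 1) ∧ Nat.card W = f r ∧ ¬ InTopMinors C r T} d

/-! ### First-order logic of coloured graphs -/

/-- The relation symbols: a binary adjacency symbol and `t` unary colour symbols. -/
inductive ColoredGraphRel (t : ℕ) : ℕ → Type
  | adj : ColoredGraphRel t 2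
  | color (i : Fin t) : ColoredGraphRel t 1

/-- The first-order language of graphs with `t` colours. -/
def coloredGraphLang (t : ℕ) : FirstOrder.Language.{0, 0} where
  Functions := fun _ => Empty
  Relations := ColoredGraphRel t

/-- A coloured graph as a first-order structure. -/
instance ColoredGraph.instStructure {t : ℕ} (G : ColoredGraph.{u} t) :
    (coloredGraphLang t).Structure G.V where
  funMap := fun f _ => Empty.elim f
  RelMap := fun R x =>
    match R, x with
    | ColoredGraphRel.adj, x => G.graph.Adj (x 0) (x 1)
    | ColoredGraphRel.color i, x => x 0 ∈ G.color i

/-- The size of a formula: the number of its symbols (relation symbols, `=`, variables, `⊥`, `→`,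
`∀`). The terms of the language are just the variables, and `¬`, `∧`, `∨`, `∃` are the usual
abbreviations, each of constant length. -/
def formulaSize {t : ℕ} {α : Type u} :
    {n : ℕ} → (coloredGraphLang t).BoundedFormula α n → ℕ
  | _, .falsum => 1
  | _, .equal _ _ => 3
  | _, .rel (l := l) _ _ => l + 1
  | _, .imp φ ψ => formulaSize φ + formulaSize ψ + 1
  | _, .all φ => formulaSize φ + 2

/-! ### Alternation rank -/

/-- Formulas in negation normal form (free variables in `α`, and `n` more variables). -/
inductive NNFormula (L : FirstOrder.Language.{0, 0}) (α : Type u) : ℕ → Type u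
  | bot {n : ℕ} : NNFormula L α n
  | top {n : ℕ} : NNFormula L α n
  | eq {n : ℕ} (s₁ s₂ : L.Term (α ⊕ Fin n)) : NNFormula L α n
  | neq {n : ℕ} (s₁ s₂ : L.Term (α ⊕ Fin n)) : NNFormula L α n
  | rel {n l : ℕ} (R : L.Relations l) (ts : Fin l → L.Term (α ⊕ Fin n)) : NNFormula L α n
  | nrel {n l : ℕ} (R : L.Relations l) (ts : Fin l → L.Term (α ⊕ Fin n)) : NNFormula L α n
  | and {n : ℕ} (φ ψ : NNFormula L α n) : NNFormula L α n
  | or {n : ℕ} (φ ψ : NNFormula L α n) : NNFormula L α n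
  | ex {n : ℕ} (φ : NNFormula L α (n + 1)) : NNFormula L α n
  | all {n : ℕ} (φ : NNFormula L α (n + 1)) : NNFormula L α n

/-- `toNNF true φ` is the negation normal form of `φ`, and `toNNF false φ` that of `¬ φ`. -/
def toNNF {L : FirstOrder.Language.{0, 0}} {α : Type u} :
    {n : ℕ} → Bool → L.BoundedFormula α n → NNFormula L α n
  | _, true, .falsum => .bot
  | _, false, .falsum => .top
  | _, true, .equal s₁ s₂ => .eq s₁ s₂
  | _, false, .equal s₁ s₂ => .neq s₁ s₂
  | _, true, .rel R ts => .rel R ts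
  | _, false, .rel R ts => .nrel R ts
  | _, true, .imp φ ψ => .or (toNNF false φ) (toNNF true ψ)
  | _, false, .imp φ ψ => .and (toNNF true φ) (toNNF false ψ)
  | _, true, .all φ => .all (toNNF true φ)
  | _, false, .all φ => .ex (toNNF false φ)

/-- The two quantifier symbols. -/
inductive QuantSymbol
  | ex
  | all
  deriving DecidableEq

/-- The quantifier words of the branches of the syntax tree, read from the root to the leaves. -/
def NNFormula.branchWords {L : FirstOrder.Language.{0, 0}} {α : Type u} :
    {n : ℕ} → NNFormula L α n → List (List QuantSymbol)
  | _, .bot => [ [] ]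
  | _, .top => [ [] ]
  | _, .eq _ _ => [ [] ]
  | _, .neq _ _ => [ [] ]
  | _, .rel _ _ => [ [] ]
  | _, .nrel _ _ => [ [] ]
  | _, .and φ ψ => φ.branchWords ++ ψ.branchWords
  | _, .or φ ψ => φ.branchWords ++ ψ.branchWords
  | _, .ex φ => φ.branchWords.map (QuantSymbol.ex :: ·)
  | _, .all φ => φ.branchWords.map (QuantSymbol.all :: ·)

/-- The number of places in a word where a symbol is followed by the other one. -/
def alternations : List QuantSymbol → ℕ
  | [] => 0
  | [_] => 0
  | a :: b :: w => (if a = b then 0 else 1) + alternations (b :: w)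

/-- The alternation rank of a formula: the maximal number of alternations on a branch of the
syntax tree of its negation normal form. -/
def alternationRank {L : FirstOrder.Language.{0, 0}} {α : Type u} {n : ℕ} (φ : L.BoundedFormula α n) : ℕ :=
  ((toNNF true φ).branchWords.map alternations).foldr max 0

/-- `φ` and `ψ` are equivalent on the class `C`. -/
def EquivalentOn {t : ℕ} {α : Type v} (C : Set (ColoredGraph.{u} t))
    (φ ψ : (coloredGraphLang t).Formula α) : Prop :=
  ∀ G ∈ C, ∀ x : α → G.V, φ.Realize x ↔ ψ.Realize x

/-! Excluding a tree makes a game on graphs short, and a short game makes first-order types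
definable with few alternations.

The game. In each round an opponent picks a vertex, Splitter deletes a batch of at most `n` vertices
of its ball of radius `R`, and play continues on the rest of the ball. Suppose that some tree of
depth `d + 1` is not a shallow topological minor. Call a vertex deep if it roots a fan of short
paths, disjoint apart from that vertex, whose ends root such fans in turn, `d` levels down. With
enough paths per fan the tree embeds greedily below a deep vertex
(`isShallowTopMinor_of_hasDeepFan`), so there is none. Then every ball contains boundedly many
vertices that are deep to level `d - 1`; Splitter deletes these, and wins after `d` rounds
(`splitterWins_of_not_hasDeepFan`).

Locality. In the spirit of Gaifman's theorem, two structures are equivalent for `q` rounds of the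
Ehrenfeucht–Fraïssé game if each scattered tuple of one has a counterpart in the other with
equivalent balls (`ef_of_scatterTransfer`).

Types. By induction on `d`, the `q`-round type of a structure on which Splitter wins in `d` rounds
is determined by boundedly many short queries (`exists_hasTypes`). The query for `d + 1` rounds says
that there are scattered vertices, each with a batch in its ball, such that Splitter wins `d` rounds
once the batch is deleted and the remainder has a prescribed type. Adjacency to the deleted vertices
is kept as new colours. That Splitter wins has to be part of the query, as the induction hypothesis
speaks only of such structures. "Splitter wins `d` rounds" starts with `∀` and has `2 * d`
alternations, so the new query, starting with `∃`, has `2 * d + 1`.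

Conclusion. A formula is, on the class, a disjunction of descriptions of types
(`exists_equivalentOn`). This has alternation rank at most `2 * d`, which is at most `3 * d - 1` for
`d ≥ 1`. For fixed `d` all bounds are elementary, apart from the sizes of the excluded trees that
enter them. -/

/-! ### Balls in induced subgraphs, and the batched splitter game -/

/-- The `r`-neighbourhood of `A` in the subgraph of `G` induced by `U`. -/
def nbhd {V : Type u} (G : SimpleGraph V) (U A : Set V) : ℕ → Set V
  | 0 => A ∩ U
  | r + 1 => {y | y ∈ U ∧ ∃ z ∈ nbhd G U A r, z = y ∨ G.Adj z y}

/-- Splitter wins the `d`-round batched splitter game of radius `R` with batches of size `n` on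
the subgraph of `G` induced by `U`. -/
def SplitterWins {V : Type u} (G : SimpleGraph V) (R n : ℕ) : ℕ → Set V → Prop
  | 0, U => ∀ x, x ∉ U
  | d + 1, U => ∀ x, x ∈ U → ∃ s : Fin n → V, (∀ j, s j ∈ nbhd G U {x} R) ∧
      SplitterWins G R n d (nbhd G U {x} R \ Set.range s)

section nbhd

variable {V : Type u} {G : SimpleGraph V} {U A : Set V}

theorem nbhd_subset (r : ℕ) : nbhd G U A r ⊆ U := by
  cases r with
  | zero => exact Set.inter_subset_right
  | succ r => exact fun y hy => hy.1

theorem nbhd_mono_center {B : Set V} (h : A ⊆ B) (r : ℕ) : nbhd G U A r ⊆ nbhd G U B r := by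
  induction r with
  | zero => exact Set.inter_subset_inter_left _ h
  | succ r ih => exact fun y ⟨hy, z, hz, hzy⟩ => ⟨hy, z, ih hz, hzy⟩

theorem nbhd_mono_dom {U' : Set V} (h : U ⊆ U') (r : ℕ) : nbhd G U A r ⊆ nbhd G U' A r := by
  induction r with
  | zero => exact Set.inter_subset_inter_right _ h
  | succ r ih => exact fun y ⟨hy, z, hz, hzy⟩ => ⟨h hy, z, ih hz, hzy⟩

theorem nbhd_mono_radius {r r' : ℕ} (h : r ≤ r') : nbhd G U A r ⊆ nbhd G U A r' := by
  induction h with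
  | refl => exact subset_rfl
  | step _ ih => exact fun y hy => ⟨nbhd_subset _ hy, y, ih hy, Or.inl rfl⟩

theorem mem_nbhd_iff_exists {r : ℕ} {y : V} :
    y ∈ nbhd G U A r ↔ ∃ a ∈ A, y ∈ nbhd G U {a} r := by
  constructor
  · induction r generalizing y with
    | zero => exact fun hy => ⟨y, hy.1, rfl, hy.2⟩
    | succ r ih =>
      rintro ⟨hy, z, hz, hzy⟩
      obtain ⟨a, ha, hz⟩ := ih hz
      exact ⟨a, ha, hy, z, hz, hzy⟩
  · rintro ⟨a, ha, hy⟩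
    exact nbhd_mono_center (Set.singleton_subset_iff.2 ha) _ hy

theorem mem_nbhd_zero {a : V} (ha : a ∈ A) (hU : a ∈ U) : a ∈ nbhd G U A 0 := ⟨ha, hU⟩

theorem mem_nbhd_self {x : V} (hx : x ∈ U) (r : ℕ) : x ∈ nbhd G U {x} r :=
  nbhd_mono_radius (Nat.zero_le r) ⟨rfl, hx⟩

theorem mem_of_mem_nbhd_singleton {r : ℕ} {x y : V} (h : y ∈ nbhd G U {x} r) : x ∈ U := by
  induction r generalizing y with
  | zero => exact h.1 ▸ h.2
  | succ r ih => exact ih h.2.choose_spec.1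

theorem nbhd_trans {r r' : ℕ} {y z : V} (hz : z ∈ nbhd G U A r) (hy : y ∈ nbhd G U {z} r') :
    y ∈ nbhd G U A (r + r') := by
  induction r' generalizing y with
  | zero => exact (Set.mem_singleton_iff.1 hy.1) ▸ hz
  | succ r' ih =>
    obtain ⟨hy, w, hw, hwy⟩ := hy
    exact ⟨hy, w, ih hw, hwy⟩

theorem nbhd_symm {r : ℕ} {x y : V} (h : y ∈ nbhd G U {x} r) : x ∈ nbhd G U {y} r := by
  induction r generalizing y with
  | zero => exact ⟨(Set.mem_singleton_iff.1 h.1).symm, mem_of_mem_nbhd_singleton h⟩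
  | succ r ih =>
    obtain ⟨hy, z, hz, hzy⟩ := h
    have h1 : z ∈ nbhd G U {y} 1 :=
      ⟨nbhd_subset _ hz, y, ⟨rfl, hy⟩, hzy.imp Eq.symm SimpleGraph.Adj.symm⟩
    rw [add_comm]
    exact nbhd_trans h1 (ih hz)

theorem nbhd_empty (r : ℕ) : nbhd G U ∅ r = ∅ := by
  ext y
  rw [mem_nbhd_iff_exists]
  simp

theorem nbhd_insert (c : V) (r : ℕ) : nbhd G U (insert c A) r = nbhd G U {c} r ∪ nbhd G U A r := by
  ext y
  rw [Set.mem_union, mem_nbhd_iff_exists, mem_nbhd_iff_exists (A := A)]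
  simp

/-- Short paths that start well inside a ball do not leave it. -/
theorem nbhd_nbhd_singleton {B : Set V} {b a a' : ℕ} {x : V} (hx : x ∈ nbhd G U B b)
    (ha : a' ≤ a) : nbhd G (nbhd G U B (b + a)) {x} a' = nbhd G U {x} a' := by
  apply subset_antisymm (nbhd_mono_dom (nbhd_subset _) _)
  intro y hy
  induction a' generalizing y with
  | zero => exact ⟨hy.1, (Set.mem_singleton_iff.1 hy.1) ▸ nbhd_mono_radius (by omega) hx⟩
  | succ a' ih =>
    have hy' := nbhd_mono_radius (show b + (a' + 1) ≤ b + a by omega) (nbhd_trans hx hy)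
    obtain ⟨_, z, hz, hzy⟩ := hy
    exact ⟨hy', z, ih (by omega) hz, hzy⟩

theorem nbhd_nbhd {B : Set V} {b a a' : ℕ} (hA : A ⊆ nbhd G U B b)
    (ha : a' ≤ a) : nbhd G (nbhd G U B (b + a)) A a' = nbhd G U A a' := by
  ext y
  rw [mem_nbhd_iff_exists, mem_nbhd_iff_exists (U := U)]
  refine exists_congr fun x => and_congr_right fun hx => ?_
  rw [nbhd_nbhd_singleton (hA hx) ha]

theorem nbhd_disjoint {r : ℕ} {c : V} (hc : c ∉ nbhd G U A (2 * r + 1)) {y z : V}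
    (hy : y ∈ nbhd G U {c} r) (hz : z ∈ nbhd G U A r) : y ≠ z ∧ ¬ G.Adj z y := by
  have key : ¬ (z = y ∨ G.Adj z y) := by
    intro h
    have h1 : y ∈ nbhd G U A (r + 1) := ⟨nbhd_subset _ hy, z, hz, h⟩
    have h2 := nbhd_trans h1 (nbhd_symm hy)
    exact hc (nbhd_mono_radius (by omega) h2)
  exact ⟨fun h => key (Or.inl h.symm), fun h => key (Or.inr h)⟩

/-- Splitter keeps the strategy for the larger set. A batch vertex outside the smaller ball need not
be deleted; as batches have exactly `n` entries, the opponent's vertex `x` takes its place. -/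
theorem SplitterWins.mono {R n d : ℕ} {U' : Set V} (h : SplitterWins G R n d U) (hU : U' ⊆ U) :
    SplitterWins G R n d U' := by
  classical
  induction d generalizing U U' with
  | zero => exact fun x hx => h x (hU hx)
  | succ d ih =>
    intro x hx
    obtain ⟨s, hs, hw⟩ := h x (hU hx)
    refine ⟨fun j => if s j ∈ nbhd G U' {x} R then s j else x, fun j => ?_, ih hw ?_⟩
    · dsimp only
      split_ifs with hj
      · exact hj
      · exact mem_nbhd_self hx R
    · rintro y ⟨hy, hys⟩
      refine ⟨nbhd_mono_dom hU _ hy, ?_⟩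
      rintro ⟨j, rfl⟩
      exact hys ⟨j, by simp [hy]⟩

theorem exists_walk_of_mem_nbhd {r : ℕ} {x y : V} (h : y ∈ nbhd G U {x} r) :
    ∃ p : G.Walk x y, p.length ≤ r ∧ ∀ z ∈ p.support, z ∈ U := by
  induction r generalizing y with
  | zero =>
    obtain ⟨rfl, h⟩ := h
    exact ⟨.nil, le_rfl, by simpa using h⟩
  | succ r ih =>
    obtain ⟨hy, z, hz, hzy⟩ := h
    obtain ⟨p, hp, hpU⟩ := ih hz
    rcases hzy with rfl | hzy
    · exact ⟨p, by omega, hpU⟩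
    · refine ⟨p.concat hzy, by simpa using hp, fun w hw => ?_⟩
      rw [SimpleGraph.Walk.support_concat] at hw
      simp only [List.mem_append, List.mem_singleton] at hw
      rcases hw with hw | rfl
      · exact hpU w hw
      · exact hy

end nbhd

/-! ### Fans of paths -/

/-- `M` paths of `G[U]` of length at most `ρ` from `x` to vertices of `S`, pairwise disjoint apart
from `x`. -/
def HasFan {V : Type u} (G : SimpleGraph V) (U : Set V) (ρ M : ℕ) (x : V) (S : Set V) : Prop :=
  ∃ (y : Fin M → V) (P : ∀ i, G.Walk x (y i)),
    (∀ i, y i ∈ S ∧ y i ≠ x ∧ (P i).IsPath ∧ (P i).length ≤ ρ ∧ ∀ z ∈ (P i).support, z ∈ U) ∧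
    ∀ i j, i ≠ j → ∀ z ∈ (P i).support, z ∈ (P j).support → z = x

/-- `x` is the root of a hereditarily `M`-fold fan of depth `j`. -/
def HasDeepFan {V : Type u} (G : SimpleGraph V) (U : Set V) (ρ M : ℕ) : ℕ → V → Prop
  | 0, x => x ∈ U
  | j + 1, x => x ∈ U ∧ HasFan G U ρ M x {y | HasDeepFan G U ρ M j y}

section fan

variable {V : Type u} {G : SimpleGraph V} {U : Set V} {ρ M : ℕ}

theorem HasFan.mono {U' S S' : Set V} {x : V} (h : HasFan G U ρ M x S) (hU : U ⊆ U')
    (hS : S ⊆ S') : HasFan G U' ρ M x S' := by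
  obtain ⟨y, P, h1, h2⟩ := h
  exact ⟨y, P, fun i => ⟨hS (h1 i).1, (h1 i).2.1, (h1 i).2.2.1, (h1 i).2.2.2.1,
    fun z hz => hU ((h1 i).2.2.2.2 z hz)⟩, h2⟩

theorem HasDeepFan.mono {U' : Set V} (hU : U ⊆ U') {j : ℕ} {x : V}
    (h : HasDeepFan G U ρ M j x) : HasDeepFan G U' ρ M j x := by
  induction j generalizing x with
  | zero => exact hU h
  | succ j ih => exact ⟨hU h.1, h.2.mono hU fun y hy => ih hy⟩

theorem HasDeepFan.mem {j : ℕ} {x : V} (h : HasDeepFan G U ρ M j x) : x ∈ U := by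
  cases j with
  | zero => exact h
  | succ j => exact h.1

/-- A path from the center that avoids a fan extends it. -/
theorem HasFan.extend_or_cover {S : Set V} {x : V} {m : ℕ} (h : HasFan G U ρ m x S)
    (hext : ¬ HasFan G U ρ (m + 1) x S) :
    ∃ K : Finset V, K.card ≤ m * (ρ + 1) ∧ (∀ p ∈ K, p ∈ U ∧ p ≠ x) ∧
      ∀ y ∈ S, y ≠ x → ∀ q : G.Walk x y, q.IsPath → q.length ≤ ρ → (∀ z ∈ q.support, z ∈ U) →
        ∃ p ∈ K, p ∈ q.support := by
  classical
  obtain ⟨y, P, h1, h2⟩ := h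
  refine ⟨Finset.univ.biUnion fun i => (P i).support.toFinset.erase x, ?_, ?_, ?_⟩
  · refine (Finset.card_biUnion_le_card_mul _ _ (ρ + 1) fun i _ => ?_).trans (by simp)
    refine (Finset.card_erase_le).trans ((List.toFinset_card_le _).trans ?_)
    rw [SimpleGraph.Walk.length_support]
    have := (h1 i).2.2.2.1
    omega
  · intro p hp
    simp only [Finset.mem_biUnion, Finset.mem_univ, true_and, Finset.mem_erase,
      List.mem_toFinset] at hp
    obtain ⟨i, hpx, hp⟩ := hp
    exact ⟨(h1 i).2.2.2.2 p hp, hpx⟩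
  · intro y' hy' hyx q hq hql hqU
    by_contra hcon
    push Not at hcon
    apply hext
    have hav : ∀ i, ∀ z ∈ (P i).support, z ∈ q.support → z = x := by
      intro i z hz hzq
      by_contra hzx
      exact hcon z (by simp only [Finset.mem_biUnion, Finset.mem_univ, true_and, Finset.mem_erase,
        List.mem_toFinset]; exact ⟨i, hzx, hz⟩) hzq
    refine ⟨Fin.cons y' y, Fin.cases q P, ?_, ?_⟩
    · intro i
      refine Fin.cases ?_ (fun i => ?_) i
      · exact ⟨hy', hyx, hq, hql, hqU⟩
      · exact h1 i
    · intro i j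
      refine Fin.cases ?_ (fun i => ?_) i <;> refine Fin.cases ?_ (fun j => ?_) j
      · exact fun h => absurd rfl h
      · exact fun _ z hz hz' => hav j z hz' hz
      · exact fun _ z hz hz' => hav i z hz hz'
      · exact fun hij z hz hz' => h2 i j (fun h => hij (h ▸ rfl)) z hz hz'

/-- The bound on the number of vertices of `S` in a ball, when `S` has no large fan. -/
def fanBound (ρ M : ℕ) : ℕ → ℕ
  | 0 => 1
  | R + 1 => 1 + M * (ρ + 1) * fanBound ρ M R

theorem fanBound_le (ρ M R : ℕ) : fanBound ρ M R ≤ (1 + M * (ρ + 1)) ^ R := by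
  induction R with
  | zero => simp [fanBound]
  | succ R ih =>
    have h1 : 1 ≤ (1 + M * (ρ + 1)) ^ R := Nat.one_le_pow _ _ (by omega)
    calc fanBound ρ M (R + 1) ≤ (1 + M * (ρ + 1)) ^ R + M * (ρ + 1) * (1 + M * (ρ + 1)) ^ R :=
          Nat.add_le_add h1 (Nat.mul_le_mul_left _ ih)
      _ = (1 + M * (ρ + 1)) ^ (R + 1) := by ring

/-- A maximal fan from `x` into `S` has fewer than `M` paths, and its vertices other than `x` meet
every short path from `x` to another vertex of `S`. From the first such meeting point to `S` the
remaining path is shorter, so induction on `R` applies there: this is the recursion of `fanBound`.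
-/
theorem exists_finset_of_not_hasFan {S : Set V} (hfan : ∀ z ∈ U, ¬ HasFan G U ρ M z S) (R : ℕ)
    (hR : R ≤ ρ) (x : V) (hx : x ∈ U) :
    ∃ K : Finset V, K.card ≤ fanBound ρ M R ∧ ∀ y ∈ S,
      (∃ p : G.Walk x y, p.length ≤ R ∧ ∀ z ∈ p.support, z ∈ U) → y ∈ K := by
  classical
  induction R generalizing x with
  | zero =>
    refine ⟨{x}, by simp [fanBound], ?_⟩
    rintro y - ⟨p, hp, -⟩
    simpa using (SimpleGraph.Walk.eq_of_length_eq_zero (Nat.le_zero.1 hp)).symm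
  | succ R ih =>
    obtain ⟨m, hm, hfm, hfm'⟩ : ∃ m, m < M ∧ HasFan G U ρ m x S ∧ ¬ HasFan G U ρ (m + 1) x S := by
      by_contra hcon
      push Not at hcon
      have : ∀ m, m ≤ M → HasFan G U ρ m x S := by
        intro m
        induction m with
        | zero => exact fun _ => ⟨Fin.elim0, fun i => i.elim0, fun i => i.elim0, fun i => i.elim0⟩
        | succ m ihm => exact fun hm => hcon m (by omega) (ihm (by omega))
      exact hfan x hx (this M le_rfl)
    obtain ⟨K, hK, hKU, hcov⟩ := hfm.extend_or_cover hfm'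
    choose! L hL hLS using fun p (hp : p ∈ U) => ih (by omega) p hp
    refine ⟨insert x (K.biUnion L), ?_, ?_⟩
    · refine (Finset.card_insert_le _ _).trans ?_
      rw [fanBound, add_comm]
      refine Nat.add_le_add_left ?_ _
      refine (Finset.card_biUnion_le_card_mul _ _ _ fun p hp => hL p (hKU p hp).1).trans ?_
      exact Nat.mul_le_mul_right _ (hK.trans (Nat.mul_le_mul_right _ hm.le))
    · rintro y hy ⟨p, hp, hpU⟩
      by_cases hyx : y = x
      · simp [hyx]
      have hbU : ∀ z ∈ p.bypass.support, z ∈ U :=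
        fun z hz => hpU z (p.support_bypass_subset_support hz)
      have hbl := p.length_bypass_le_length
      obtain ⟨w, hwK, hw⟩ := hcov y hy hyx p.bypass p.bypass_isPath (by omega) hbU
      refine Finset.mem_insert_of_mem (Finset.mem_biUnion.2 ⟨w, hwK, ?_⟩)
      refine hLS w (hKU w hwK).1 y hy ⟨p.bypass.dropUntil w hw, ?_, fun z hz => hbU z
        (SimpleGraph.Walk.support_dropUntil_subset_support _ _ hz)⟩
      have := SimpleGraph.Walk.length_dropUntil_lt_length hw (hKU w hwK).2
      omega

/-- Splitter answers `x` with all vertices of the ball that root a fan of one level less. No vertex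
of `U` has an `M`-fan into the set of these, so they fit into a batch; what remains has no deep fan
of that level, since fans persist in larger sets. -/
theorem splitterWins_of_not_hasDeepFan {R n d : ℕ} (hR : R ≤ ρ) (hn : fanBound ρ M R ≤ n)
    (h : ∀ x, ¬ HasDeepFan G U ρ M d x) : SplitterWins G R n d U := by
  classical
  induction d generalizing U with
  | zero => exact h
  | succ d ih =>
    intro x hx
    obtain ⟨K, hK, hKS⟩ := exists_finset_of_not_hasFan
      (S := {y | HasDeepFan G U ρ M d y}) (fun z hz hf => h z ⟨hz, hf⟩) R hR x hx
    obtain ⟨s, hs⟩ : ∃ s : Fin n → V, ∀ y ∈ K, ∃ j, s j = y := by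
      refine ⟨fun j => if hj : j.1 < K.card then K.equivFin.symm ⟨j, hj⟩ else x, fun y hy => ?_⟩
      refine ⟨⟨K.equivFin ⟨y, hy⟩, (K.equivFin ⟨y, hy⟩).2.trans_le (hK.trans hn)⟩, ?_⟩
      simp
    refine ⟨fun j => if s j ∈ nbhd G U {x} R then s j else x, fun j => ?_, ih fun y hy => ?_⟩
    · dsimp only
      split_ifs with hj
      · exact hj
      · exact mem_nbhd_self hx R
    · have hmem := hy.mem
      have hyU : HasDeepFan G U ρ M d y :=
        hy.mono (Set.sdiff_subset.trans (nbhd_subset _))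
      obtain ⟨j, rfl⟩ := hs y (hKS y hyU (exists_walk_of_mem_nbhd hmem.1))
      exact hmem.2 ⟨j, by simp [hmem.1]⟩

/-- A fan has a path that avoids a given small set of vertices. -/
theorem HasFan.exists_avoiding {S : Set V} {x : V} (h : HasFan G U ρ M x S) (K : Finset V)
    (hK : K.card < M) : ∃ y ∈ S, y ≠ x ∧ ∃ p : G.Walk x y, p.IsPath ∧ p.length ≤ ρ ∧
      ∀ z ∈ p.support, z ∈ K → z = x := by
  classical
  obtain ⟨y, P, h1, h2⟩ := h
  by_contra hcon
  push Not at hcon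
  choose z hz hzK hzx using fun i =>
    hcon (y i) (h1 i).1 (h1 i).2.1 (P i) (h1 i).2.2.1 (h1 i).2.2.2.1
  have hinj : Function.Injective z := fun i j hij => by
    by_contra hne
    exact hzx i (h2 i j hne (z i) (hz i) (hij ▸ hz j))
  have := Finset.card_le_card_of_injOn (s := Finset.univ) z (fun i _ => hzK i) hinj.injOn
  simp at this
  omega

end fan

/-! ### Greedy embedding of trees -/

/-- The parent of a vertex is the last but one vertex of its unique path from the root. -/
theorem exists_parent {W : Type v} {T : SimpleGraph W} (hT : T.IsTree) (root : W) :
    ∃ par : W → W,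
      (∀ a, a ≠ root → T.Adj (par a) a ∧ T.dist root a = T.dist root (par a) + 1) ∧
      ∀ a b, T.Adj a b → (b ≠ root ∧ par b = a) ∨ (a ≠ root ∧ par a = b) := by
  choose p hp hpl using hT.1.exists_path_of_dist root
  have key : ∀ a b, T.Adj a b → T.dist root b = T.dist root a + 1 →
      b ≠ root ∧ (p b).penultimate = a := by
    intro a b hab hd
    refine ⟨fun hb => by subst hb; simp at hd, ?_⟩
    have hq : ((p a).concat hab).IsPath := by
      apply SimpleGraph.Walk.isPath_of_length_eq_dist
      rw [SimpleGraph.Walk.length_concat, hpl, hd]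
    have := congrArg Subtype.val ((hT.2.subsingleton_path root b).elim ⟨p b, hp b⟩ ⟨_, hq⟩)
    simp only at this
    rw [this, SimpleGraph.Walk.penultimate_concat]
  have hadj : ∀ a b, T.Adj a b → (b ≠ root ∧ (p b).penultimate = a) ∨
      (a ≠ root ∧ (p a).penultimate = b) := by
    intro a b hab
    rcases hT.dist_eq_dist_add_one_of_adj root hab with h | h
    · exact Or.inr (key b a hab.symm h)
    · exact Or.inl (key a b hab h)
  refine ⟨fun a => (p a).penultimate, fun a ha => ?_, hadj⟩
  have hnil : ¬ (p a).Nil := SimpleGraph.Walk.not_nil_of_ne ha.symm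
  have h1 := SimpleGraph.Walk.adj_penultimate hnil
  refine ⟨h1, ?_⟩
  rcases hT.dist_eq_dist_add_one_of_adj root h1 with h | h
  · exfalso
    have h2 := SimpleGraph.dist_le ((p a).dropLast)
    have h3 := hpl a
    have h4 : (p a).dropLast.length = (p a).length - 1 := by simp
    omega
  · exact h

/-- A partial embedding, as a subdivision, of the part `s` of a rooted tree: `f` is defined on the
vertices, and `Z a` is the vertex set of the path to `a` from its parent. -/
structure PartialEmbedding {W : Type v} {V : Type u} (T : SimpleGraph W) (root : W)
    (par : W → W) (G : SimpleGraph V) (ρ M d : ℕ) (s : Finset W) (f : W → V)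
    (Z : W → Finset V) : Prop where
  inj : ∀ a ∈ s, ∀ b ∈ s, f a = f b → a = b
  deep : ∀ a ∈ s, HasDeepFan G Set.univ ρ M (d - T.dist root a) (f a)
  path : ∀ a ∈ s, a ≠ root → ∃ p : G.Walk (f (par a)) (f a), p.IsPath ∧ p.length ≤ ρ ∧
    ∀ z, z ∈ p.support ↔ z ∈ Z a
  card_le : ∀ a ∈ s, (Z a).card ≤ ρ + 1
  avoid : ∀ a ∈ s, a ≠ root → ∀ c ∈ s, f c ∈ Z a → c = a ∨ c = par a
  disj : ∀ a ∈ s, ∀ b ∈ s, a ≠ b → a ≠ root → b ≠ root → ∀ z ∈ Z a, z ∈ Z b →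
    ∃ c ∈ s, f c = z

section embedding

variable {W : Type v} {V : Type u} {T : SimpleGraph W} {root : W} {par : W → W}
  {G : SimpleGraph V} {ρ M d : ℕ}

/-- The `M` paths of the fan at the image of the parent meet only in that image. At most `s.card *
(ρ + 2)` vertices are in use, namely, for each embedded tree vertex, its image and a path of at most
`ρ + 1` vertices. Hence one path of the fan avoids all of them except its start, and it ends in a
vertex that is deep enough for the levels still to come. -/
theorem PartialEmbedding.insert [DecidableEq W] {s : Finset W} {f : W → V} {Z : W → Finset V}
    (h : PartialEmbedding T root par G ρ M d s f Z) {a : W} (ha : a ∉ s) (har : a ≠ root)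
    (hpar : ∀ c ∈ s, c ≠ root → par c ∈ s) (hpa : par a ∈ s)
    (hdist : T.dist root a = T.dist root (par a) + 1) (hd : T.dist root a ≤ d)
    (hM : s.card * (ρ + 2) < M) :
    ∃ f' Z', PartialEmbedding T root par G ρ M d (insert a s) f' Z' := by
  classical
  have hdeep := h.deep (par a) hpa
  obtain ⟨j, hj⟩ : ∃ j, d - T.dist root (par a) = j + 1 :=
    ⟨d - T.dist root a, by omega⟩
  rw [hj] at hdeep
  have hj' : d - T.dist root a = j := by omega
  have hcard : (s.biUnion fun c => Insert.insert (f c) (Z c)).card < M := by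
    refine (Finset.card_biUnion_le_card_mul _ _ (ρ + 2) fun c hc => ?_).trans_lt hM
    exact (Finset.card_insert_le _ _).trans (Nat.succ_le_succ (h.card_le c hc))
  obtain ⟨y, hy, hyx, p, hp, hpl, hpK⟩ := hdeep.2.exists_avoiding _ hcard
  have hf : ∀ c ∈ s, f c ∈ p.support → c = par a := by
    intro c hc hcp
    exact h.inj c hc _ hpa
      (hpK _ hcp (Finset.mem_biUnion.2 ⟨c, hc, Finset.mem_insert_self _ _⟩))
  have hZ : ∀ c ∈ s, ∀ z ∈ Z c, z ∈ p.support → z = f (par a) := by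
    intro c hc z hz hzp
    exact hpK _ hzp (Finset.mem_biUnion.2 ⟨c, hc, Finset.mem_insert_of_mem hz⟩)
  have hne : ∀ c ∈ s, c ≠ a := fun c hc h => ha (h ▸ hc)
  have hf' : ∀ c ∈ s, Function.update f a y c = f c :=
    fun c hc => Function.update_of_ne (hne c hc) _ _
  have hZ' : ∀ c ∈ s, Function.update Z a p.support.toFinset c = Z c :=
    fun c hc => Function.update_of_ne (hne c hc) _ _
  have hyf : ∀ c ∈ s, f c ≠ y := by
    intro c hc hcy
    have := hf c hc (hcy ▸ p.end_mem_support)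
    exact hyx (by rw [← hcy, this])
  have hyZ : ∀ c ∈ s, y ∉ Z c := fun c hc hcy => hyx (hZ c hc y hcy p.end_mem_support)
  refine ⟨Function.update f a y, Function.update Z a p.support.toFinset, ?_, ?_, ?_, ?_, ?_, ?_⟩
  · intro b hB c hC hbc
    rcases Finset.mem_insert.1 hB with rfl | hb <;> rcases Finset.mem_insert.1 hC with rfl | hc
    · rfl
    · rw [Function.update_self, hf' c hc] at hbc
      exact absurd hbc.symm (hyf c hc)
    · rw [Function.update_self, hf' b hb] at hbc
      exact absurd hbc (hyf b hb)
    · rw [hf' b hb, hf' c hc] at hbc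
      exact h.inj b hb c hc hbc
  · intro b hB
    rcases Finset.mem_insert.1 hB with rfl | hb
    · rw [Function.update_self, hj']
      exact hy
    · rw [hf' b hb]
      exact h.deep b hb
  · intro b hB hbr
    rcases Finset.mem_insert.1 hB with rfl | hb
    · rw [Function.update_self, Function.update_self, hf' _ hpa]
      exact ⟨p, hp, hpl, fun z => by simp⟩
    · rw [hf' b hb, hZ' b hb, hf' _ (hpar b hb hbr)]
      exact h.path b hb hbr
  · intro b hB
    rcases Finset.mem_insert.1 hB with rfl | hb
    · rw [Function.update_self]
      refine (List.toFinset_card_le _).trans ?_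
      rw [SimpleGraph.Walk.length_support]
      omega
    · rw [hZ' b hb]
      exact h.card_le b hb
  · intro b hB hbr c hC hcb
    rcases Finset.mem_insert.1 hB with rfl | hb <;> rcases Finset.mem_insert.1 hC with rfl | hc
    · exact Or.inl rfl
    · rw [Function.update_self, hf' c hc, List.mem_toFinset] at hcb
      exact Or.inr (hf c hc hcb)
    · rw [Function.update_self, hZ' b hb] at hcb
      exact absurd hcb (hyZ b hb)
    · rw [hf' c hc, hZ' b hb] at hcb
      exact h.avoid b hb hbr c hc hcb
  · intro b hB c hC hbc hbr hcr z hzb hzc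
    rcases Finset.mem_insert.1 hB with rfl | hb <;> rcases Finset.mem_insert.1 hC with rfl | hc
    · exact absurd rfl hbc
    · rw [Function.update_self, List.mem_toFinset] at hzb
      rw [hZ' c hc] at hzc
      exact ⟨par b, Finset.mem_insert_of_mem hpa, by rw [hf' _ hpa, hZ c hc z hzc hzb]⟩
    · rw [Function.update_self, List.mem_toFinset] at hzc
      rw [hZ' b hb] at hzb
      exact ⟨par c, Finset.mem_insert_of_mem hpa, by rw [hf' _ hpa, hZ b hb z hzb hzc]⟩
    · rw [hZ' b hb] at hzb
      rw [hZ' c hc] at hzc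
      obtain ⟨e, he, hez⟩ := h.disj b hb c hc hbc hbr hcr z hzb hzc
      exact ⟨e, Finset.mem_insert_of_mem he, by rw [hf' e he, hez]⟩

/-- Tree vertices are added in order of their distance from the root, so that the parent always
comes before the child. -/
theorem exists_partialEmbedding [Fintype W]
    (hpar : ∀ a, a ≠ root → T.Adj (par a) a ∧ T.dist root a = T.dist root (par a) + 1)
    (hconn : T.Connected) (hd : ∀ a, T.dist root a ≤ d) (hM : Fintype.card W * (ρ + 2) < M) {x : V}
    (hx : HasDeepFan G Set.univ ρ M d x) (s : Finset W) (hs : ∀ a ∈ s, a ≠ root → par a ∈ s) :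
    ∃ f Z, PartialEmbedding T root par G ρ M d s f Z := by
  classical
  induction s using Finset.induction_on_max_value (fun a => T.dist root a) with
  | empty => exact ⟨fun _ => x, fun _ => ∅, by constructor <;> simp⟩
  | insert a s ha hmax ih =>
    have hs' : ∀ c ∈ s, c ≠ root → par c ∈ s := by
      intro c hc hcr
      refine (Finset.mem_insert.1 (hs c (Finset.mem_insert_of_mem hc) hcr)).resolve_left fun h => ?_
      have h1 := (hpar c hcr).2
      have h2 := hmax c hc
      rw [h] at h1
      omega
    by_cases har : a = root
    · subst har
      have hs0 : s = ∅ := by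
        refine Finset.eq_empty_of_forall_notMem fun c hc => ?_
        have h2 := hmax c hc
        rw [SimpleGraph.dist_self, Nat.le_zero, hconn.dist_eq_zero_iff] at h2
        exact ha (h2 ▸ hc)
      subst hs0
      refine ⟨fun _ => x, fun _ => ∅, ?_⟩
      constructor <;> simp [hx]
    · obtain ⟨f, Z, h⟩ := ih hs'
      have hpa : par a ∈ s := by
        refine (Finset.mem_insert.1 (hs a (Finset.mem_insert_self _ _) har)).resolve_left fun h => ?_
        exact (hpar a har).1.ne h
      exact h.insert ha har hs' hpa (hpar a har).2 (hd a)
        ((Nat.mul_le_mul_right _ (Finset.card_le_univ s)).trans_lt hM)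

theorem isShallowTopMinor_of_hasDeepFan {r : ℕ} [Finite W] (hT : T.IsTree)
    (hd : ∀ a, T.dist root a ≤ d) (hM : Nat.card W * (r + 3) < M) {x : V}
    (hx : HasDeepFan G Set.univ (r + 1) M d x) : IsShallowTopMinor r T G := by
  classical
  have := Fintype.ofFinite W
  obtain ⟨par, hpar, hadj⟩ := exists_parent hT root
  obtain ⟨f, Z, h⟩ := exists_partialEmbedding hpar hT.1 hd (by simpa using hM) hx Finset.univ
    (by simp)
  have key : ∀ a b, T.Adj a b → ∃ p : G.Walk (f a) (f b), (p.IsPath ∧ p.length ≤ r + 1) ∧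
      ∃ e, e ≠ root ∧ s(a, b) = s(e, par e) ∧ ∀ z, z ∈ p.support → z ∈ Z e := by
    intro a b hab
    rcases hadj a b hab with ⟨hb, rfl⟩ | ⟨ha, rfl⟩
    · obtain ⟨p, hp, hl, hz⟩ := h.path b (Finset.mem_univ _) hb
      exact ⟨p, ⟨hp, hl⟩, b, hb, Sym2.eq_swap, fun z => (hz z).1⟩
    · obtain ⟨p, hp, hl, hz⟩ := h.path a (Finset.mem_univ _) ha
      exact ⟨p.reverse, ⟨hp.reverse, by simpa using hl⟩, a, ha, rfl, fun z => by
        simpa using (hz z).1⟩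
  choose P hP e he hse hPZ using key
  refine ⟨⟨f, fun a b hab => h.inj a (Finset.mem_univ _) b (Finset.mem_univ _) hab⟩, P, hP, ?_, ?_⟩
  · intro a b hab w hw
    have h1 := h.avoid (e a b hab) (Finset.mem_univ _) (he a b hab) w (Finset.mem_univ _)
      (hPZ a b hab _ hw)
    have h2 := hse a b hab
    have h3 : w ∈ s(a, b) := by
      rw [h2, Sym2.mem_iff]
      exact h1
    exact Sym2.mem_iff.1 h3
  · intro a b hab a' b' hab' hne z hz hz'
    have hee : e a b hab ≠ e a' b' hab' := by
      intro h
      apply hne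
      rw [hse a b hab, hse a' b' hab', h]
    obtain ⟨c, -, hc⟩ := h.disj _ (Finset.mem_univ _) _ (Finset.mem_univ _) hee (he a b hab)
      (he a' b' hab') z (hPZ a b hab z hz) (hPZ a' b' hab' z hz')
    exact ⟨c, hc⟩

end embedding

/-- If a tree of depth `d + 1` is not an `r`-shallow topological minor of `G`, then Splitter wins
the `d`-round batched splitter game on `G`. -/
theorem splitterWins_of_not_isShallowTopMinor {W : Type v} {V : Type u} [Finite W]
    {T : SimpleGraph W} {root : W} {G : SimpleGraph V} {r d n : ℕ}
    (hT : IsRootedTreeOfDepth T root (d + 1)) (h : ¬ IsShallowTopMinor r T G)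
    (hn : (1 + (Nat.card W * (r + 3) + 1) * (r + 2)) ^ r ≤ n) :
    SplitterWins G r n d Set.univ := by
  -- At most `r` internal vertices means length at most `r + 1`. The value of `M` exceeds the
  -- `Nat.card W * (r + 3)` vertices that an embedded tree can occupy.
  refine splitterWins_of_not_hasDeepFan (ρ := r + 1) (M := Nat.card W * (r + 3) + 1) (by omega)
    ((fanBound_le _ _ _).trans hn) fun x hx => h ?_
  refine isShallowTopMinor_of_hasDeepFan (root := root) hT.1 (fun a => ?_) (Nat.lt_succ_self _) hx
  have := hT.2.2 ⟨a, rfl⟩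
  simp only at this
  omega

/-! ### Ehrenfeucht–Fraïssé games -/

/-- A graph on `V` with colours indexed by `ι`, and a set of vertices to play on. -/
structure World (ι : Type) (V : Type u) where
  /-- the graph -/
  graph : SimpleGraph V
  /-- the colours -/
  col : ι → Set V
  /-- the vertices that may be played -/
  dom : Set V

/-- The same graph, played on `U`. -/
def World.on {ι : Type} {V : Type u} (w : World ι V) (U : Set V) : World ι V :=
  { w with dom := U }

/-- The pairs of `ρ` form a partial isomorphism. -/
def PartialIso {ι : Type} {V V' : Type u} (w : World ι V) (w' : World ι V')
    (ρ : Set (V × V')) : Prop :=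
  ∀ p ∈ ρ, (∀ i, p.1 ∈ w.col i ↔ p.2 ∈ w'.col i) ∧
    ∀ q ∈ ρ, (p.1 = q.1 ↔ p.2 = q.2) ∧ (w.graph.Adj p.1 q.1 ↔ w'.graph.Adj p.2 q.2)

/-- Duplicator wins the `k`-round game from the position `ρ`. -/
def EF {ι : Type} {V V' : Type u} (w : World ι V) (w' : World ι V') :
    ℕ → Set (V × V') → Prop
  | 0, ρ => PartialIso w w' ρ
  | k + 1, ρ => PartialIso w w' ρ ∧
      (∀ c ∈ w.dom, ∃ c' ∈ w'.dom, EF w w' k (insert (c, c') ρ)) ∧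
      (∀ c' ∈ w'.dom, ∃ c ∈ w.dom, EF w w' k (insert (c, c') ρ))

section EF

variable {ι : Type} {V V' V'' : Type u} {w : World ι V} {w' : World ι V'} {w'' : World ι V''}
  {ρ σ : Set (V × V')} {k : ℕ}

theorem PartialIso.mono (h : PartialIso w w' ρ) (hs : σ ⊆ ρ) : PartialIso w w' σ :=
  fun p hp => ⟨(h p (hs hp)).1, fun q hq => (h p (hs hp)).2 q (hs hq)⟩

theorem EF.partialIso (h : EF w w' k ρ) : PartialIso w w' ρ := by
  cases k with
  | zero => exact h
  | succ k => exact h.1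

theorem EF.mono (h : EF w w' k ρ) (hs : σ ⊆ ρ) : EF w w' k σ := by
  induction k generalizing ρ σ with
  | zero => exact PartialIso.mono h hs
  | succ k ih =>
    refine ⟨h.1.mono hs, fun c hc => ?_, fun c' hc' => ?_⟩
    · obtain ⟨c', hc', h'⟩ := h.2.1 c hc
      exact ⟨c', hc', ih h' (Set.insert_subset_insert hs)⟩
    · obtain ⟨c, hc, h'⟩ := h.2.2 c' hc'
      exact ⟨c, hc, ih h' (Set.insert_subset_insert hs)⟩

theorem EF.pred (h : EF w w' (k + 1) ρ) : EF w w' k ρ := by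
  induction k generalizing ρ with
  | zero => exact h.1
  | succ k ih =>
    refine ⟨h.1, fun c hc => ?_, fun c' hc' => ?_⟩
    · obtain ⟨c', hc', h'⟩ := h.2.1 c hc
      exact ⟨c', hc', ih h'⟩
    · obtain ⟨c, hc, h'⟩ := h.2.2 c' hc'
      exact ⟨c, hc, ih h'⟩

theorem EF.of_le {l : ℕ} (h : EF w w' k ρ) (hl : l ≤ k) : EF w w' l ρ := by
  induction hl with
  | refl => exact h
  | step _ ih => exact ih h.pred

theorem PartialIso.symm (h : PartialIso w w' ρ) : PartialIso w' w (Prod.swap '' ρ) := by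
  rintro _ ⟨p, hp, rfl⟩
  refine ⟨fun i => ((h p hp).1 i).symm, ?_⟩
  rintro _ ⟨q, hq, rfl⟩
  exact ⟨((h p hp).2 q hq).1.symm, ((h p hp).2 q hq).2.symm⟩

theorem EF.symm (h : EF w w' k ρ) : EF w' w k (Prod.swap '' ρ) := by
  induction k generalizing ρ with
  | zero => exact PartialIso.symm h
  | succ k ih =>
    refine ⟨h.1.symm, fun c hc => ?_, fun c' hc' => ?_⟩
    · obtain ⟨c', hc', h'⟩ := h.2.2 c hc
      have := ih h'
      rw [Set.image_insert_eq] at this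
      exact ⟨c', hc', this⟩
    · obtain ⟨c, hc, h'⟩ := h.2.1 c' hc'
      have := ih h'
      rw [Set.image_insert_eq] at this
      exact ⟨c, hc, this⟩

theorem EF.trans {τ : Set (V' × V'')} (h : EF w w' k ρ) (h' : EF w' w'' k τ) :
    EF w w'' k {p | ∃ b, (p.1, b) ∈ ρ ∧ (b, p.2) ∈ τ} := by
  have hiso : ∀ {ρ : Set (V × V')} {τ : Set (V' × V'')}, PartialIso w w' ρ → PartialIso w' w'' τ →
      PartialIso w w'' {p | ∃ b, (p.1, b) ∈ ρ ∧ (b, p.2) ∈ τ} := by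
    rintro ρ τ h h' p ⟨b, hb, hb'⟩
    refine ⟨fun i => ((h _ hb).1 i).trans ((h' _ hb').1 i), ?_⟩
    rintro q ⟨e, he, he'⟩
    exact ⟨((h _ hb).2 _ he).1.trans ((h' _ hb').2 _ he').1,
      ((h _ hb).2 _ he).2.trans ((h' _ hb').2 _ he').2⟩
  have hsub : ∀ (ρ : Set (V × V')) (τ : Set (V' × V'')) (a : V) (b : V') (c : V''),
      insert (a, c) {p : V × V'' | ∃ b, (p.1, b) ∈ ρ ∧ (b, p.2) ∈ τ} ⊆
        {p | ∃ e, (p.1, e) ∈ insert (a, b) ρ ∧ (e, p.2) ∈ insert (b, c) τ} := by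
    rintro ρ τ a b c p (rfl | ⟨e, he, he'⟩)
    · exact ⟨b, Set.mem_insert _ _, Set.mem_insert _ _⟩
    · exact ⟨e, Set.mem_insert_of_mem _ he, Set.mem_insert_of_mem _ he'⟩
  induction k generalizing ρ τ with
  | zero => exact hiso h h'
  | succ k ih =>
    refine ⟨hiso h.1 h'.1, fun a ha => ?_, fun c hc => ?_⟩
    · obtain ⟨b, hb, h1⟩ := h.2.1 a ha
      obtain ⟨c, hc, h2⟩ := h'.2.1 b hb
      exact ⟨c, hc, (ih h1 h2).mono (hsub _ _ _ _ _)⟩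
    · obtain ⟨b, hb, h1⟩ := h'.2.2 c hc
      obtain ⟨a, ha, h2⟩ := h.2.2 b hb
      exact ⟨a, ha, (ih h2 h1).mono (hsub _ _ _ _ _)⟩

/-- With nothing to play on, the game is decided by the initial position. This starts both the local
strategy at the empty position and the induction on `d`. -/
theorem EF.of_dom_empty (hw : w.dom = ∅) (hw' : w'.dom = ∅) (h : PartialIso w w' ρ) :
    EF w w' k ρ := by
  cases k with
  | zero => exact h
  | succ k => exact ⟨h, by simp [hw], by simp [hw']⟩

/-- A distance of at most `r` is detected in `r` rounds, by playing the vertices of a short path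
backwards from `y`. -/
theorem EF.mem_nbhd {r : ℕ} (h : EF w w' k ρ) (hr : r ≤ k) {x y : V} {x' y' : V'}
    (hx : (x, x') ∈ ρ) (hy : (y, y') ∈ ρ) (hy' : y' ∈ w'.dom)
    (hxy : y ∈ nbhd w.graph w.dom {x} r) : y' ∈ nbhd w'.graph w'.dom {x'} r := by
  induction r generalizing k ρ y y' with
  | zero => exact ⟨((h.partialIso _ hy).2 _ hx).1.1 hxy.1, hy'⟩
  | succ r ih =>
    obtain ⟨k, rfl⟩ : ∃ l, k = l + 1 := ⟨k - 1, by omega⟩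
    obtain ⟨hyU, z, hz, hzy⟩ := hxy
    obtain ⟨z', hz', h'⟩ := h.2.1 z (nbhd_subset _ hz)
    refine ⟨hy', z', ih h' (by omega) (Set.mem_insert_of_mem _ hx) (Set.mem_insert _ _) hz' hz, ?_⟩
    have := (h'.partialIso _ (Set.mem_insert _ _)).2 _ (Set.mem_insert_of_mem _ hy)
    exact hzy.imp this.1.1 this.2.1

theorem EF.mem_nbhd' {r : ℕ} (h : EF w w' k ρ) (hr : r ≤ k) {x y : V} {x' y' : V'}
    (hx : (x, x') ∈ ρ) (hy : (y, y') ∈ ρ) (hyU : y ∈ w.dom)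
    (hxy : y' ∈ nbhd w'.graph w'.dom {x'} r) : y ∈ nbhd w.graph w.dom {x} r :=
  h.symm.mem_nbhd hr ⟨_, hx, rfl⟩ ⟨_, hy, rfl⟩ hyU hxy

/-- The game can be restricted to balls around some of the pairs played. -/
theorem EF.restrict_nbhd {r : ℕ} {π : Set (V × V')} (h : EF w w' (k + r) ρ) (hπ : π ⊆ ρ) :
    EF (w.on (nbhd w.graph w.dom (Prod.fst '' π) r))
      (w'.on (nbhd w'.graph w'.dom (Prod.snd '' π) r)) k ρ := by
  induction k generalizing ρ with
  | zero => exact h.partialIso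
  | succ k ih =>
    rw [show k + 1 + r = k + r + 1 by omega] at h
    refine ⟨h.partialIso, fun c hc => ?_, fun c' hc' => ?_⟩
    · obtain ⟨_, ⟨p, hp, rfl⟩, hcp⟩ := mem_nbhd_iff_exists.1 hc
      obtain ⟨c', hc', h'⟩ := h.2.1 c (nbhd_subset _ hcp)
      refine ⟨c', ?_, ih h' (hπ.trans (Set.subset_insert _ _))⟩
      exact mem_nbhd_iff_exists.2 ⟨p.2, ⟨p, hp, rfl⟩, h'.mem_nbhd (by omega)
        (Set.mem_insert_of_mem _ (hπ hp)) (Set.mem_insert _ _) hc' hcp⟩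
    · obtain ⟨_, ⟨p, hp, rfl⟩, hcp⟩ := mem_nbhd_iff_exists.1 hc'
      obtain ⟨c, hc, h'⟩ := h.2.2 c' (nbhd_subset _ hcp)
      refine ⟨c, ?_, ih h' (hπ.trans (Set.subset_insert _ _))⟩
      exact mem_nbhd_iff_exists.2 ⟨p.1, ⟨p, hp, rfl⟩, h'.mem_nbhd' (by omega)
        (Set.mem_insert_of_mem _ (hπ hp)) (Set.mem_insert _ _) hc hcp⟩

/-- Strategies on two parts without edges between them combine. -/
theorem EF.union {A B : Set V} {A' B' : Set V'}
    (hAB : ∀ a ∈ A, ∀ b ∈ B, a ≠ b ∧ ¬ w.graph.Adj b a)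
    (hAB' : ∀ a ∈ A', ∀ b ∈ B', a ≠ b ∧ ¬ w'.graph.Adj b a)
    (h : EF (w.on A) (w'.on A') k ρ) (h' : EF (w.on B) (w'.on B') k σ)
    (hρ : ∀ p ∈ ρ, p.1 ∈ A ∧ p.2 ∈ A') (hσ : ∀ p ∈ σ, p.1 ∈ B ∧ p.2 ∈ B') :
    EF (w.on (A ∪ B)) (w'.on (A' ∪ B')) k (ρ ∪ σ) := by
  have hiso : ∀ {ρ σ : Set (V × V')}, PartialIso (w.on A) (w'.on A') ρ →
      PartialIso (w.on B) (w'.on B') σ → (∀ p ∈ ρ, p.1 ∈ A ∧ p.2 ∈ A') →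
      (∀ p ∈ σ, p.1 ∈ B ∧ p.2 ∈ B') → PartialIso (w.on (A ∪ B)) (w'.on (A' ∪ B')) (ρ ∪ σ) := by
    intro ρ σ h h' hρ hσ p hp
    refine ⟨hp.elim (fun hp => (h p hp).1) (fun hp => (h' p hp).1), fun q hq => ?_⟩
    rcases hp with hp | hp <;> rcases hq with hq | hq
    · exact (h p hp).2 q hq
    · have h1 := hAB _ (hρ p hp).1 _ (hσ q hq).1
      have h2 := hAB' _ (hρ p hp).2 _ (hσ q hq).2
      exact ⟨iff_of_false h1.1 h2.1, iff_of_false (fun h => h1.2 h.symm) (fun h => h2.2 h.symm)⟩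
    · have h1 := hAB _ (hρ q hq).1 _ (hσ p hp).1
      have h2 := hAB' _ (hρ q hq).2 _ (hσ p hp).2
      exact ⟨iff_of_false (fun h => h1.1 h.symm) (fun h => h2.1 h.symm), iff_of_false h1.2 h2.2⟩
    · exact (h' p hp).2 q hq
  have hins : ∀ {ρ : Set (V × V')} {A : Set V} {A' : Set V'} {c c'},
      (∀ p ∈ ρ, p.1 ∈ A ∧ p.2 ∈ A') → c ∈ A → c' ∈ A' →
      ∀ p ∈ insert (c, c') ρ, p.1 ∈ A ∧ p.2 ∈ A' := by
    rintro ρ A A' c c' h hc hc' p (rfl | hp)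
    · exact ⟨hc, hc'⟩
    · exact h p hp
  induction k generalizing ρ σ with
  | zero => exact hiso h h' hρ hσ
  | succ k ih =>
    refine ⟨hiso h.1 h'.1 hρ hσ, ?_, ?_⟩
    · rintro c (hc | hc)
      · obtain ⟨c', hc', h1⟩ := h.2.1 c hc
        have := ih h1 h'.pred (hins hρ hc hc') hσ
        rw [Set.insert_union] at this
        exact ⟨c', Or.inl hc', this⟩
      · obtain ⟨c', hc', h1⟩ := h'.2.1 c hc
        have := ih h.pred h1 hρ (hins hσ hc hc')
        rw [Set.union_insert] at this
        exact ⟨c', Or.inr hc', this⟩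
    · rintro c' (hc' | hc')
      · obtain ⟨c, hc, h1⟩ := h.2.2 c' hc'
        have := ih h1 h'.pred (hins hρ hc hc') hσ
        rw [Set.insert_union] at this
        exact ⟨c, Or.inl hc, this⟩
      · obtain ⟨c, hc, h1⟩ := h'.2.2 c' hc'
        have := ih h.pred h1 hρ (hins hσ hc hc')
        rw [Set.union_insert] at this
        exact ⟨c, Or.inr hc, this⟩

/-- Deleting the vertices `s`, while recording the adjacency to them by new colours. -/
def World.delete {κ : Type} (w : World ι V) (s : κ → V) : World (ι ⊕ κ) V where
  graph := w.graph
  col := Sum.elim w.col fun k => {y | w.graph.Adj (s k) y}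
  dom := w.dom \ Set.range s

/-- A strategy after the deletion of vertices gives one before it. -/
theorem EF.of_delete {κ : Type} {s : κ → V} {s' : κ → V'}
    (hs : ∀ k, s k ∈ w.dom) (hs' : ∀ k, s' k ∈ w'.dom)
    (hiso : PartialIso w w' (Set.range fun k => (s k, s' k)))
    (h : EF (w.delete s) (w'.delete s') k ρ)
    (hρ : ∀ p ∈ ρ, p.1 ∉ Set.range s ∧ p.2 ∉ Set.range s') :
    EF w w' k (ρ ∪ Set.range fun k => (s k, s' k)) := by
  have hcomb : ∀ {ρ : Set (V × V')}, PartialIso (w.delete s) (w'.delete s') ρ →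
      (∀ p ∈ ρ, p.1 ∉ Set.range s ∧ p.2 ∉ Set.range s') →
      PartialIso w w' (ρ ∪ Set.range fun k => (s k, s' k)) := by
    intro ρ h hρ p hp
    refine ⟨hp.elim (fun hp i => (h p hp).1 (Sum.inl i)) (fun hp => (hiso p hp).1), fun q hq => ?_⟩
    rcases hp with hp | ⟨k, rfl⟩ <;> rcases hq with hq | ⟨l, rfl⟩
    · exact (h p hp).2 q hq
    · refine ⟨iff_of_false (fun h => (hρ p hp).1 ⟨l, h.symm⟩) (fun h => (hρ p hp).2 ⟨l, h.symm⟩), ?_⟩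
      rw [SimpleGraph.adj_comm, SimpleGraph.adj_comm w'.graph]
      exact (h p hp).1 (Sum.inr l)
    · exact ⟨iff_of_false (fun h => (hρ q hq).1 ⟨k, h⟩) (fun h => (hρ q hq).2 ⟨k, h⟩),
        (h q hq).1 (Sum.inr k)⟩
    · exact (hiso _ ⟨k, rfl⟩).2 _ ⟨l, rfl⟩
  have hins : ∀ {ρ : Set (V × V')} {c c'},
      (∀ p ∈ ρ, p.1 ∉ Set.range s ∧ p.2 ∉ Set.range s') → c ∉ Set.range s → c' ∉ Set.range s' →
      ∀ p ∈ insert (c, c') ρ, p.1 ∉ Set.range s ∧ p.2 ∉ Set.range s' := by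
    rintro ρ c c' h hc hc' p (rfl | hp)
    · exact ⟨hc, hc'⟩
    · exact h p hp
  induction k generalizing ρ with
  | zero => exact hcomb h hρ
  | succ k ih =>
    refine ⟨hcomb h.1 hρ, fun c hc => ?_, fun c' hc' => ?_⟩
    · by_cases hcs : c ∈ Set.range s
      · obtain ⟨l, rfl⟩ := hcs
        refine ⟨s' l, hs' l, ?_⟩
        exact (ih h.pred hρ).mono (Set.insert_subset (Or.inr ⟨l, rfl⟩) subset_rfl)
      · obtain ⟨c', hc', h'⟩ := h.2.1 c ⟨hc, hcs⟩
        have := ih h' (hins hρ hcs hc'.2)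
        rw [Set.insert_union] at this
        exact ⟨c', hc'.1, this⟩
    · by_cases hcs : c' ∈ Set.range s'
      · obtain ⟨l, rfl⟩ := hcs
        refine ⟨s l, hs l, ?_⟩
        exact (ih h.pred hρ).mono (Set.insert_subset (Or.inr ⟨l, rfl⟩) subset_rfl)
      · obtain ⟨c, hc, h'⟩ := h.2.2 c' ⟨hc', hcs⟩
        have := ih h' (hins hρ hc.2 hcs)
        rw [Set.insert_union] at this
        exact ⟨c, hc.1, this⟩

theorem EF.play_tuple {e : ℕ} (h : EF w w' (k + e) ρ) (y' : Fin e → V')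
    (hy' : ∀ j, y' j ∈ w'.dom) :
    ∃ y : Fin e → V, (∀ j, y j ∈ w.dom) ∧ EF w w' k (ρ ∪ Set.range fun j => (y j, y' j)) := by
  induction e generalizing ρ with
  | zero => exact ⟨Fin.elim0, fun j => j.elim0, by simpa using h⟩
  | succ e ih =>
    obtain ⟨c, hc, h'⟩ := h.2.2 (y' 0) (hy' 0)
    obtain ⟨y, hy, h2⟩ := ih h' (fun j => y' j.succ) (fun j => hy' _)
    refine ⟨Fin.cons c y, fun j => Fin.cases hc hy j, h2.mono ?_⟩
    rintro p (hp | ⟨j, rfl⟩)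
    · exact Or.inl (Set.mem_insert_of_mem _ hp)
    · refine Fin.cases ?_ (fun j => ?_) j
      · exact Or.inl (Set.mem_insert _ _)
      · exact Or.inr ⟨j, rfl⟩

end EF

/-! ### Locality of the game -/

/-- The radius of the balls that matter when `i` rounds are left. -/
def localRadius : ℕ → ℕ
  | 0 => 0
  -- With `r` the old radius, scattered vertices are more than `4 * r + 2` apart, and replies to far
  -- vertices must be more than `2 * r + 1` from the position. A move is near if it is within `6 * r
  -- + 3 = (2 * r + 1) + (4 * r + 2)`; its own `r`-ball then lies within `7 * r + 3`.
  | i + 1 => 7 * localRadius i + 3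

/-- The number of rounds of the local games when `i` of `q` rounds are left. -/
def localRank (q : ℕ) : ℕ → ℕ
  | 0 => 0
  -- The surplus pays for the move itself, or for up to `q` auxiliary moves in the far case, and
  -- then for testing distances and restricting to smaller balls.
  | i + 1 => localRank q i + q + 7 * localRadius i + 10

theorem localRadius_le (i : ℕ) : localRadius i + 1 ≤ 7 ^ i := by
  induction i with
  | zero => simp [localRadius]
  | succ i ih => rw [localRadius, pow_succ]; omega

theorem localRadius_mono {i j : ℕ} (h : i ≤ j) : localRadius i ≤ localRadius j := by
  induction h with
  | refl => exact le_rfl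
  | step _ ih => rw [localRadius]; omega

theorem localRank_mono (q : ℕ) {i j : ℕ} (h : i ≤ j) : localRank q i ≤ localRank q j := by
  induction h with
  | refl => exact le_rfl
  | step _ ih => rw [localRank]; omega

theorem localRank_le (q i : ℕ) : localRank q i ≤ i * (q + 7 ^ (i + 1) + 10) := by
  induction i with
  | zero => simp [localRank]
  | succ i ih =>
    have h1 := localRadius_le i
    have h2 : 7 ^ (i + 1) ≤ 7 ^ (i + 1 + 1) := Nat.pow_le_pow_right (by norm_num) (by omega)
    have h3 : 7 ^ (i + 1) = 7 * 7 ^ i := by ring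
    calc localRank q (i + 1) = localRank q i + q + 7 * localRadius i + 10 := rfl
      _ ≤ i * (q + 7 ^ (i + 1) + 10) + (q + 7 ^ (i + 1) + 10) := by omega
      _ = (i + 1) * (q + 7 ^ (i + 1) + 10) := by ring
      _ ≤ (i + 1) * (q + 7 ^ (i + 1 + 1) + 10) := Nat.mul_le_mul_left _ (by omega)

/-- The balls of radius `r` around `x` and `x'` are equivalent for `k` rounds. -/
def LocallyEquiv {ι : Type} {V V' : Type u} (w : World ι V) (w' : World ι V') (r k : ℕ)
    (x : V) (x' : V') : Prop :=
  EF (w.on (nbhd w.graph w.dom {x} r)) (w'.on (nbhd w'.graph w'.dom {x'} r)) k {(x, x')}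

/-- The vertices of the tuple `x` of `w` are pairwise at distance more than `D`. -/
def Scattered {ι : Type} {V : Type u} (w : World ι V) (D : ℕ) {e : ℕ} (x : Fin e → V) : Prop :=
  (∀ j, x j ∈ w.dom) ∧ ∀ j l, j ≠ l → x l ∉ nbhd w.graph w.dom {x j} D

/-- Scattered tuples of `w` have locally equivalent scattered counterparts in `w'`. -/
def ScatterTransfer {ι : Type} {V V' : Type u} (w : World ι V) (w' : World ι V') (q : ℕ) : Prop :=
  ∀ i < q, ∀ e ≤ q, ∀ x : Fin e → V, Scattered w (4 * localRadius i + 2) x →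
    ∃ x' : Fin e → V', Scattered w' (4 * localRadius i + 2) x' ∧
      ∀ j, LocallyEquiv w w' (localRadius i) (localRank q i) (x j) (x' j)

/-- The invariant of Duplicator's strategy when `i` of `q` rounds are left. -/
structure LocalInvariant {ι : Type} {V V' : Type u} (w : World ι V) (w' : World ι V') (q i : ℕ)
    (ρ : Set (V × V')) : Prop where
  finite : ρ.Finite
  card_le : ρ.ncard + i ≤ q
  mem : ∀ p ∈ ρ, p.1 ∈ w.dom ∧ p.2 ∈ w'.dom
  ef : EF (w.on (nbhd w.graph w.dom (Prod.fst '' ρ) (localRadius i)))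
    (w'.on (nbhd w'.graph w'.dom (Prod.snd '' ρ) (localRadius i))) (localRank q i) ρ

section locality

variable {ι : Type} {V V' V'' : Type u} {w : World ι V} {w' : World ι V'} {w'' : World ι V''}
  {ρ : Set (V × V')} {q i : ℕ}

theorem LocallyEquiv.symm {r k : ℕ} {x : V} {x' : V'} (h : LocallyEquiv w w' r k x x') :
    LocallyEquiv w' w r k x' x := by
  have := EF.symm h
  rwa [Set.image_singleton] at this

theorem LocallyEquiv.trans {r k : ℕ} {x : V} {x' : V'} {x'' : V''}
    (h : LocallyEquiv w w' r k x x') (h' : LocallyEquiv w' w'' r k x' x'') :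
    LocallyEquiv w w'' r k x x'' :=
  (EF.trans h h').mono (by simp)

theorem LocalInvariant.symm (h : LocalInvariant w w' q i ρ) :
    LocalInvariant w' w q i (Prod.swap '' ρ) where
  finite := h.finite.image _
  card_le := (Nat.add_le_add_right (Set.ncard_image_le h.finite) _).trans h.card_le
  mem := by
    rintro _ ⟨p, hp, rfl⟩
    exact (h.mem p hp).symm
  ef := by
    have := h.ef.symm
    rw [Set.image_image, Set.image_image]
    exact this

/-- Two vertices in the same ball of radius `r` are within `2 * r`, so each pair of the position
accounts for at most one vertex of the tuple. -/
theorem card_le_of_scattered {A' : Set V'} {r e : ℕ} {y : Fin e → V'}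
    (hy : Scattered w' (2 * r) y) (hA : ρ.Finite) (hρ : Prod.snd '' ρ = A')
    (hn : ∀ j, y j ∈ nbhd w'.graph w'.dom A' r) : e ≤ ρ.ncard := by
  subst hρ
  have : ∀ j, ∃ p ∈ ρ, y j ∈ nbhd w'.graph w'.dom {p.2} r := by
    intro j
    obtain ⟨_, ⟨p, hp, rfl⟩, h⟩ := mem_nbhd_iff_exists.1 (hn j)
    exact ⟨p, hp, h⟩
  choose p hp hyp using this
  have hinj : Function.Injective p := by
    intro j l hjl
    by_contra hne
    refine hy.2 j l hne ?_
    have := nbhd_trans (nbhd_symm (hyp j)) (hjl ▸ hyp l)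
    rwa [← two_mul] at this
  have hc := Set.ncard_le_ncard (Set.range_subset_iff.2 hp) hA
  rwa [← Set.image_univ, Set.ncard_image_of_injective _ hinj, Set.ncard_univ, Nat.card_fin] at hc

/-- A vertex far from the current position has an equivalent counterpart. -/
theorem LocalInvariant.exists_far (H : ScatterTransfer w w' q)
    (h : LocalInvariant w w' q (i + 1) ρ) {c : V} (hc : c ∈ w.dom)
    (hfar : c ∉ nbhd w.graph w.dom (Prod.fst '' ρ) (6 * localRadius i + 3)) :
    ∃ c' ∈ w'.dom, c' ∉ nbhd w'.graph w'.dom (Prod.snd '' ρ) (2 * localRadius i + 1) ∧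
      LocallyEquiv w w' (localRadius i) (localRank q i) c c' := by
  have hef := h.ef
  have hcard := h.card_le
  set r := localRadius i with hr
  set Q := localRank q i with hQ
  have hr' : localRadius (i + 1) = 7 * r + 3 := rfl
  have hQ' : localRank q (i + 1) = Q + q + 7 * r + 10 := rfl
  rw [hr', hQ'] at hef
  set A := Prod.fst '' ρ with hA
  set A' := Prod.snd '' ρ with hA'
  -- Suppose that all counterparts of `c` are near the position. Then scattered tuples of
  -- counterparts have bounded length, and a longest one can be lengthened: copy it into `w` by the
  -- local game, add `c`, and transfer the result back.
  by_contra hcon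
  push Not at hcon
  have hnear : ∀ c' ∈ w'.dom, LocallyEquiv w w' r Q c c' →
      c' ∈ nbhd w'.graph w'.dom A' (2 * r + 1) := by
    intro c' hc' hl
    by_contra hn
    exact hcon c' hc' hn hl
  let P : ℕ → Prop := fun e => ∃ y' : Fin e → V', Scattered w' (4 * r + 2) y' ∧
    ∀ j, LocallyEquiv w w' r Q c (y' j)
  have hbound : ∀ e, P e → e ≤ ρ.ncard := by
    rintro e ⟨y', hy', hl⟩
    refine card_le_of_scattered (r := 2 * r + 1) (A' := A') ?_ h.finite rfl
      (fun j => hnear _ (hy'.1 j) (hl j))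
    rwa [show 2 * (2 * r + 1) = 4 * r + 2 by ring]
  obtain ⟨e, he, he'⟩ : ∃ e, P e ∧ ¬ P (e + 1) := by
    by_contra hcon
    push Not at hcon
    have : ∀ e, P e := by
      intro e
      induction e with
      | zero => exact ⟨Fin.elim0, ⟨fun j => j.elim0, fun j => j.elim0⟩, fun j => j.elim0⟩
      | succ e ih => exact hcon e ih
    have := hbound _ (this (ρ.ncard + 1))
    omega
  have hecard := hbound e he
  apply he'
  obtain ⟨y', hy', hl⟩ := he
  have hyn : ∀ j, y' j ∈ nbhd w'.graph w'.dom A' (2 * r + 1) := fun j => hnear _ (hy'.1 j) (hl j)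
  -- The longest tuple `y'` is played in the local game. Enough rounds are left to see that the
  -- replies `y` are equally near to the position, equally scattered, and locally equivalent to
  -- `y'`.
  obtain ⟨y, hy, hply⟩ := EF.play_tuple (k := Q + 7 * r + 10)
    (hef.of_le (show Q + 7 * r + 10 + e ≤ _ by omega)) y'
    (fun j => nbhd_mono_radius (by omega) (hyn j))
  have hmem : ∀ j, (y j, y' j) ∈ ρ ∪ Set.range fun j => (y j, y' j) := fun j => Or.inr ⟨j, rfl⟩
  have hya : ∀ j, y j ∈ nbhd w.graph w.dom A (2 * r + 1) := by
    intro j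
    obtain ⟨_, ⟨p, hp, rfl⟩, hpy⟩ := mem_nbhd_iff_exists.1 (hyn j)
    have h1 : y' j ∈ nbhd w'.graph (nbhd w'.graph w'.dom A' (0 + (7 * r + 3))) {p.2} (2 * r + 1) := by
      rw [nbhd_nbhd_singleton (mem_nbhd_zero (Set.mem_image_of_mem _ hp) (h.mem p hp).2) (by omega)]
      exact hpy
    rw [zero_add] at h1
    have h2 := hply.mem_nbhd' (by omega) (Or.inl hp) (hmem j) (hy j) h1
    exact mem_nbhd_iff_exists.2 ⟨p.1, ⟨p, hp, rfl⟩, nbhd_mono_dom (nbhd_subset _) _ h2⟩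
  have hbig : 7 * r + 3 = 2 * r + 1 + (5 * r + 2) := by ring
  have hly : ∀ j, LocallyEquiv w' w r Q (y' j) (y j) := by
    intro j
    have h1 := (hply.of_le (show Q + r ≤ _ by omega)).restrict_nbhd
      (Set.singleton_subset_iff.2 (hmem j))
    have h2 := h1.mono (Set.singleton_subset_iff.2 (hmem j))
    rw [Set.image_singleton, Set.image_singleton] at h2
    have e1 : nbhd w.graph (nbhd w.graph w.dom A (7 * r + 3)) {y j} r =
        nbhd w.graph w.dom {y j} r := by
      rw [hbig, nbhd_nbhd_singleton (hya j) (by omega)]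
    have e2 : nbhd w'.graph (nbhd w'.graph w'.dom A' (7 * r + 3)) {y' j} r =
        nbhd w'.graph w'.dom {y' j} r := by
      rw [hbig, nbhd_nbhd_singleton (hyn j) (by omega)]
    have h3 : LocallyEquiv w w' r Q (y j) (y' j) := by
      unfold LocallyEquiv
      rw [← e1, ← e2]
      exact h2
    exact h3.symm
  have hysc : ∀ j l, j ≠ l → y l ∉ nbhd w.graph w.dom {y j} (4 * r + 2) := by
    intro j l hjl hn
    rw [← nbhd_nbhd_singleton (a := 5 * r + 2) (hya j) (by omega), ← hbig] at hn
    have := hply.mem_nbhd (by omega) (hmem j) (hmem l)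
      (nbhd_mono_radius (by omega) (hyn l)) hn
    exact hy'.2 j l hjl (nbhd_mono_dom (nbhd_subset _) _ this)
  -- Each `y j` is within `2 * r + 1` of the position, whereas `c` is not within `6 * r + 3` of it.
  have hyc : ∀ j, c ∉ nbhd w.graph w.dom {y j} (4 * r + 2) := by
    intro j hn
    have := nbhd_trans (hya j) hn
    exact hfar (nbhd_mono_radius (by omega) this)
  have hsc : Scattered w (4 * r + 2) (Fin.cons c y : Fin (e + 1) → V) := by
    constructor
    · intro j
      refine Fin.cases hc (fun j => ?_) j
      exact nbhd_subset _ (hy j)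
    · intro j l
      refine Fin.cases ?_ (fun j => ?_) j <;> refine Fin.cases ?_ (fun l => ?_) l
      · exact fun h => absurd rfl h
      · exact fun _ hn => hyc l (nbhd_symm hn)
      · exact fun _ hn => hyc j hn
      · exact fun hjl => hysc j l (fun h => hjl (h ▸ rfl))
  -- The length `e + 1` is admissible because `e ≤ ρ.ncard` and `ρ.ncard + (i + 1) ≤ q`.
  obtain ⟨x', hx', hlx⟩ := H i (by omega) (e + 1) (by omega) _ hsc
  refine ⟨x', hx', fun j => ?_⟩
  have := hlx j
  revert this
  refine Fin.cases ?_ (fun j => ?_) j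
  · exact fun h => h
  · exact fun h => ((hl j).trans (hly j)).trans h

/-- A near move is answered by the local game that the invariant provides. A far move is answered by
a far counterpart; the balls around it and around the old position are then disjoint with no edges
between them, so the two local strategies combine. -/
theorem LocalInvariant.exists_reply (H : ScatterTransfer w w' q)
    (h : LocalInvariant w w' q (i + 1) ρ) {c : V} (hc : c ∈ w.dom) :
    ∃ c' ∈ w'.dom, LocalInvariant w w' q i (insert (c, c') ρ) := by
  have hef := h.ef
  have hcard := h.card_le
  have hr' : localRadius (i + 1) = 7 * localRadius i + 3 := rfl
  have hQ' : localRank q (i + 1) = localRank q i + q + 7 * localRadius i + 9 + 1 := rfl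
  rw [hr', hQ'] at hef
  have hbase : ∀ c' ∈ w'.dom, (EF (w.on (nbhd w.graph w.dom (Prod.fst '' insert (c, c') ρ)
      (localRadius i))) (w'.on (nbhd w'.graph w'.dom (Prod.snd '' insert (c, c') ρ)
      (localRadius i))) (localRank q i) (insert (c, c') ρ)) →
      LocalInvariant w w' q i (insert (c, c') ρ) := by
    intro c' hc' hE
    refine ⟨h.finite.insert _, ?_, ?_, hE⟩
    · have := Set.ncard_insert_le (c, c') ρ
      omega
    · rintro p (rfl | hp)
      · exact ⟨hc, hc'⟩
      · exact h.mem p hp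
  by_cases hnear : c ∈ nbhd w.graph w.dom (Prod.fst '' ρ) (6 * localRadius i + 3)
  · obtain ⟨c', hc', h'⟩ := hef.2.1 c (nbhd_mono_radius (by omega) hnear)
    have hbig : 7 * localRadius i + 3 = 6 * localRadius i + 3 + localRadius i := by ring
    have hnear' : c' ∈ nbhd w'.graph w'.dom (Prod.snd '' ρ) (6 * localRadius i + 3) := by
      obtain ⟨_, ⟨p, hp, rfl⟩, hpc⟩ := mem_nbhd_iff_exists.1 hnear
      have h1 : c ∈ nbhd w.graph (nbhd w.graph w.dom (Prod.fst '' ρ)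
          (0 + (7 * localRadius i + 3))) {p.1} (6 * localRadius i + 3) := by
        rw [nbhd_nbhd_singleton (mem_nbhd_zero (Set.mem_image_of_mem _ hp) (h.mem p hp).1) (by omega)]
        exact hpc
      rw [zero_add] at h1
      have h2 := h'.mem_nbhd (by omega) (Set.mem_insert_of_mem _ hp) (Set.mem_insert _ _) hc' h1
      exact mem_nbhd_iff_exists.2 ⟨p.2, ⟨p, hp, rfl⟩, nbhd_mono_dom (nbhd_subset _) _ h2⟩
    refine ⟨c', nbhd_subset _ hc', hbase c' (nbhd_subset _ hc') ?_⟩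
    have h1 := (h'.of_le (show localRank q i + localRadius i ≤ _ by omega)).restrict_nbhd subset_rfl
    have s1 : Prod.fst '' insert (c, c') ρ ⊆
        nbhd w.graph w.dom (Prod.fst '' ρ) (6 * localRadius i + 3) := by
      rintro _ ⟨p, (rfl | hp), rfl⟩
      · exact hnear
      · exact nbhd_mono_radius (Nat.zero_le _) ⟨⟨p, hp, rfl⟩, (h.mem p hp).1⟩
    have s2 : Prod.snd '' insert (c, c') ρ ⊆
        nbhd w'.graph w'.dom (Prod.snd '' ρ) (6 * localRadius i + 3) := by
      rintro _ ⟨p, (rfl | hp), rfl⟩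
      · exact hnear'
      · exact nbhd_mono_radius (Nat.zero_le _) ⟨⟨p, hp, rfl⟩, (h.mem p hp).2⟩
    have e1 := nbhd_nbhd s1 (le_refl (localRadius i))
    have e2 := nbhd_nbhd s2 (le_refl (localRadius i))
    rw [← hbig] at e1 e2
    rw [← e1, ← e2]
    exact h1
  · obtain ⟨c', hc', hfar, hl⟩ := h.exists_far H hc hnear
    refine ⟨c', hc', hbase c' hc' ?_⟩
    have h1 := (hef.of_le (show localRank q i + localRadius i ≤ _ by omega)).restrict_nbhd subset_rfl
    have s1 : Prod.fst '' ρ ⊆ nbhd w.graph w.dom (Prod.fst '' ρ) 0 := by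
      rintro _ ⟨p, hp, rfl⟩
      exact ⟨⟨p, hp, rfl⟩, (h.mem p hp).1⟩
    have s2 : Prod.snd '' ρ ⊆ nbhd w'.graph w'.dom (Prod.snd '' ρ) 0 := by
      rintro _ ⟨p, hp, rfl⟩
      exact ⟨⟨p, hp, rfl⟩, (h.mem p hp).2⟩
    have e1 := nbhd_nbhd s1 (show localRadius i ≤ 7 * localRadius i + 3 by omega)
    have e2 := nbhd_nbhd s2 (show localRadius i ≤ 7 * localRadius i + 3 by omega)
    rw [zero_add] at e1 e2
    have h2 : EF (w.on (nbhd w.graph w.dom (Prod.fst '' ρ) (localRadius i)))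
        (w'.on (nbhd w'.graph w'.dom (Prod.snd '' ρ) (localRadius i))) (localRank q i) ρ := by
      rw [← e1, ← e2]
      exact h1
    rw [Set.image_insert_eq, Set.image_insert_eq, nbhd_insert, nbhd_insert, Set.insert_eq]
    refine EF.union ?_ ?_ hl h2 ?_ ?_
    · intro a ha b hb
      exact nbhd_disjoint (fun h => hnear (nbhd_mono_radius (by omega) h)) ha hb
    · intro a ha b hb
      exact nbhd_disjoint hfar ha hb
    · rintro p rfl
      exact ⟨mem_nbhd_self hc _, mem_nbhd_self hc' _⟩
    · intro p hp
      exact ⟨nbhd_mono_radius (Nat.zero_le _) (s1 ⟨p, hp, rfl⟩),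
        nbhd_mono_radius (Nat.zero_le _) (s2 ⟨p, hp, rfl⟩)⟩

theorem LocalInvariant.ef_all (H : ScatterTransfer w w' q) (H' : ScatterTransfer w' w q)
    (h : LocalInvariant w w' q i ρ) : EF w w' i ρ := by
  induction i generalizing ρ with
  | zero => exact h.ef.partialIso
  | succ i ih =>
    refine ⟨h.ef.partialIso, fun c hc => ?_, fun c' hc' => ?_⟩
    · obtain ⟨c', hc', h'⟩ := h.exists_reply H hc
      exact ⟨c', hc', ih h'⟩
    · obtain ⟨c, hc, h'⟩ := h.symm.exists_reply H' hc'
      have := h'.symm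
      rw [Set.image_insert_eq, Set.image_image] at this
      simp only [Prod.swap_swap, Set.image_id', Prod.swap_prod_mk] at this
      exact ⟨c, hc, ih this⟩

/-- Two structures with the same scattered tuples up to local equivalence are equivalent. -/
theorem ef_of_scatterTransfer (H : ScatterTransfer w w' q) (H' : ScatterTransfer w' w q) :
    EF w w' q ∅ := by
  refine LocalInvariant.ef_all H H' ⟨Set.finite_empty, by simp, by simp, ?_⟩
  refine EF.of_dom_empty ?_ ?_ (by intro p hp; exact hp.elim)
  · simp [World.on, nbhd_empty]
  · simp [World.on, nbhd_empty]

end locality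

/-! ### Elementary bounds -/

theorem tower_mono (h : ℕ) : Monotone (tower h) := by
  induction h with
  | zero => exact fun _ _ h => h
  | succ h ih => exact fun a b hab => Nat.pow_le_pow_right (by norm_num) (ih hab)

theorem tower_le_tower {h h' : ℕ} (hh : h ≤ h') (n : ℕ) : tower h n ≤ tower h' n := by
  induction hh with
  | refl => exact le_rfl
  | step _ ih => exact ih.trans (Nat.lt_two_pow_self).le

theorem tower_tower (h h' n : ℕ) : tower h (tower h' n) = tower (h + h') n := by
  induction h with
  | zero => simp [tower]
  | succ h ih => rw [tower, ih, Nat.succ_add, tower]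

theorem self_le_tower (h n : ℕ) : n ≤ tower h n := tower_le_tower (Nat.zero_le h) n

theorem le_tower_self (c n : ℕ) : c ≤ tower c n := by
  induction c with
  | zero => exact Nat.zero_le _
  | succ c ih => exact Nat.succ_le_of_lt (ih.trans_lt Nat.lt_two_pow_self)

theorem two_mul_le_two_pow (a : ℕ) : 2 * a ≤ 2 ^ a := by
  cases a with
  | zero => simp
  | succ b =>
    have : b < 2 ^ b := Nat.lt_two_pow_self
    rw [pow_succ]
    omega

theorem mul_self_le_two_pow_two_pow (a : ℕ) : a * a ≤ 2 ^ 2 ^ a := by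
  have ha : a < 2 ^ a := Nat.lt_two_pow_self
  calc a * a ≤ 2 ^ a * 2 ^ a := Nat.mul_le_mul ha.le ha.le
    _ = 2 ^ (2 * a) := by rw [← pow_add, two_mul]
    _ ≤ 2 ^ 2 ^ a := Nat.pow_le_pow_right (by norm_num) (two_mul_le_two_pow a)

namespace ElementarilyBounded

variable {f g : ℕ → ℕ}

theorem of_le (hg : ElementarilyBounded g) (h : ∀ n, f n ≤ g n) : ElementarilyBounded f :=
  let ⟨k, hk⟩ := hg
  ⟨k, fun n => (h n).trans (hk n)⟩

theorem id : ElementarilyBounded fun n => n := ⟨0, fun _ => le_rfl⟩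

theorem const (c : ℕ) : ElementarilyBounded fun _ => c := ⟨c, le_tower_self c⟩

theorem tower_comp (h : ℕ) (hg : ElementarilyBounded g) :
    ElementarilyBounded fun n => tower h (g n) :=
  let ⟨k, hk⟩ := hg
  ⟨h + k, fun n => (tower_mono h (hk n)).trans (tower_tower h k n).le⟩

theorem comp (hf : ElementarilyBounded f) (hg : ElementarilyBounded g) :
    ElementarilyBounded fun n => f (g n) :=
  let ⟨h, hh⟩ := hf
  (tower_comp h hg).of_le fun n => hh (g n)

theorem exists_common (hf : ElementarilyBounded f) (hg : ElementarilyBounded g) :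
    ∃ h, ∀ n, f n ≤ tower h n ∧ g n ≤ tower h n :=
  let ⟨h, hh⟩ := hf
  let ⟨k, hk⟩ := hg
  ⟨max h k, fun n => ⟨(hh n).trans (tower_le_tower (le_max_left _ _) n),
    (hk n).trans (tower_le_tower (le_max_right _ _) n)⟩⟩

theorem add (hf : ElementarilyBounded f) (hg : ElementarilyBounded g) :
    ElementarilyBounded fun n => f n + g n := by
  obtain ⟨h, hh⟩ := hf.exists_common hg
  refine ⟨h + 1, fun n => ?_⟩
  obtain ⟨h1, h2⟩ := hh n
  have := two_mul_le_two_pow (tower h n)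
  show f n + g n ≤ 2 ^ tower h n
  omega

theorem mul (hf : ElementarilyBounded f) (hg : ElementarilyBounded g) :
    ElementarilyBounded fun n => f n * g n := by
  obtain ⟨h, hh⟩ := hf.exists_common hg
  exact ⟨h + 2, fun n => (Nat.mul_le_mul (hh n).1 (hh n).2).trans (mul_self_le_two_pow_two_pow _)⟩

theorem pow (hf : ElementarilyBounded f) (hg : ElementarilyBounded g) :
    ElementarilyBounded fun n => f n ^ g n := by
  obtain ⟨h, hh⟩ := hf.exists_common hg
  refine ⟨h + 3, fun n => ?_⟩
  obtain ⟨h1, h2⟩ := hh n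
  calc f n ^ g n ≤ (2 ^ tower h n) ^ g n :=
        Nat.pow_le_pow_left (h1.trans Nat.lt_two_pow_self.le) _
    _ ≤ (2 ^ tower h n) ^ tower h n := Nat.pow_le_pow_right (Nat.two_pow_pos _) h2
    _ = 2 ^ (tower h n * tower h n) := (pow_mul 2 _ _).symm
    _ ≤ 2 ^ 2 ^ 2 ^ tower h n :=
        Nat.pow_le_pow_right (by norm_num) (mul_self_le_two_pow_two_pow _)

end ElementarilyBounded

/-! ### Alternations -/

/-- `∃` for `true`, `∀` for `false`. -/
def quantSymbol : Bool → QuantSymbol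
  | true => .ex
  | false => .all

theorem alternations_le_cons (a : QuantSymbol) (l : List QuantSymbol) :
    alternations l ≤ alternations (a :: l) := by
  cases l with
  | nil => exact le_rfl
  | cons b l => exact Nat.le_add_left _ _

theorem alternations_cons_le (a b : QuantSymbol) (l : List QuantSymbol) :
    alternations (a :: l) ≤ alternations (b :: l) + 1 := by
  cases l with
  | nil => simp [alternations]
  | cons c l =>
    simp only [alternations]
    split_ifs <;> omega

theorem alternations_cons_self (a : QuantSymbol) (l : List QuantSymbol) :
    alternations (a :: a :: l) = alternations (a :: l) := by
  simp [alternations]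

/-- On all branches of the negation normal forms of `∃ φ` (if `b`) or `∀ φ` (otherwise) there are
at most `n` alternations. -/
def AltBound {L : FirstOrder.Language.{0, 0}} {α : Type v} {m : ℕ} (b : Bool) (n : ℕ)
    (φ : L.BoundedFormula α m) : Prop :=
  (∀ l ∈ (toNNF true φ).branchWords, alternations (quantSymbol b :: l) ≤ n) ∧
    ∀ l ∈ (toNNF false φ).branchWords, alternations (quantSymbol (!b) :: l) ≤ n

section AltBound

variable {L : FirstOrder.Language.{0, 0}} {α : Type v} {m n : ℕ} {b : Bool}
  {φ ψ : L.BoundedFormula α m}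

theorem AltBound.mono {n' : ℕ} (h : AltBound b n φ) (hn : n ≤ n') : AltBound b n' φ :=
  ⟨fun l hl => (h.1 l hl).trans hn, fun l hl => (h.2 l hl).trans hn⟩

/-- Changing the quantifier in front costs at most one alternation. Since the count includes that
quantifier, prefixing the same quantifier is free, and all the bookkeeping of alternations reduces
to this rule and to the change of sign under negation. -/
theorem AltBound.switch (b' : Bool) (h : AltBound b n φ) : AltBound b' (n + 1) φ :=
  ⟨fun l hl => (alternations_cons_le _ _ l).trans (Nat.succ_le_succ (h.1 l hl)),
    fun l hl => (alternations_cons_le _ _ l).trans (Nat.succ_le_succ (h.2 l hl))⟩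

theorem AltBound.falsum : AltBound b n (.falsum : L.BoundedFormula α m) := by
  constructor <;> simp [toNNF, NNFormula.branchWords, alternations]

theorem AltBound.equal (s₁ s₂ : L.Term (α ⊕ Fin m)) :
    AltBound b n (.equal s₁ s₂ : L.BoundedFormula α m) := by
  constructor <;> simp [toNNF, NNFormula.branchWords, alternations]

theorem AltBound.rel {l : ℕ} (R : L.Relations l) (ts : Fin l → L.Term (α ⊕ Fin m)) :
    AltBound b n (.rel R ts : L.BoundedFormula α m) := by
  constructor <;> simp [toNNF, NNFormula.branchWords, alternations]

theorem AltBound.imp (h : AltBound (!b) n φ) (h' : AltBound b n ψ) : AltBound b n (φ.imp ψ) := by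
  constructor
  · intro l hl
    simp only [toNNF, NNFormula.branchWords, List.mem_append] at hl
    rcases hl with hl | hl
    · simpa using h.2 l hl
    · exact h'.1 l hl
  · intro l hl
    simp only [toNNF, NNFormula.branchWords, List.mem_append] at hl
    rcases hl with hl | hl
    · exact h.1 l hl
    · exact h'.2 l hl

theorem AltBound.all {φ : L.BoundedFormula α (m + 1)} (h : AltBound false n φ) :
    AltBound false n φ.all := by
  constructor
  · intro l hl
    simp only [toNNF, NNFormula.branchWords, List.mem_map] at hl
    obtain ⟨l, hl, rfl⟩ := hl
    exact (alternations_cons_self _ _).le.trans (h.1 l hl)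
  · intro l hl
    simp only [toNNF, NNFormula.branchWords, List.mem_map] at hl
    obtain ⟨l, hl, rfl⟩ := hl
    exact (alternations_cons_self _ _).le.trans (h.2 l hl)

theorem AltBound.alternationRank_le (h : AltBound b n φ) : alternationRank φ ≤ n := by
  have key : ∀ L : List ℕ, (∀ x ∈ L, x ≤ n) → L.foldr max 0 ≤ n := by
    intro L
    induction L with
    | nil => simp
    | cons a L ih =>
      intro h
      exact max_le (h a List.mem_cons_self) (ih fun x hx => h x (List.mem_cons_of_mem _ hx))
  refine key _ fun x hx => ?_
  obtain ⟨l, hl, rfl⟩ := List.mem_map.1 hx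
  exact (alternations_le_cons _ l).trans (h.1 l hl)

end AltBound

/-! ### Definable queries -/

/-- A property of tuples (indexed by `α`) of vertices of coloured graphs. -/
abbrev Query (t : ℕ) (α : Type) := ∀ G : ColoredGraph.{u} t, (α → G.V) → Prop

/-- `P` is definable by a formula of size at most `s`, with at most `n` alternations once the
quantifier `∃` (if `b`) or `∀` (otherwise) is put in front of it; the variables may be renamed. -/
def Dfn {t : ℕ} {α : Type} (b : Bool) (n s : ℕ) (P : Query.{u} t α) : Prop :=
  ∀ (k m : ℕ) (e : α → Fin k ⊕ Fin m), ∃ ψ : (coloredGraphLang t).BoundedFormula (Fin k) m,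
    AltBound b n ψ ∧ formulaSize ψ ≤ s ∧
      ∀ (G : ColoredGraph.{u} t) (v : Fin k → G.V) (xs : Fin m → G.V),
        ψ.Realize v xs ↔ P G (fun a => Sum.elim v xs (e a))

namespace Dfn

variable {t : ℕ} {α β : Type} {b : Bool} {n s s' : ℕ} {P Q : Query.{u} t α}

theorem mono (h : Dfn b n s P) {n' : ℕ} (hn : n ≤ n') (hs : s ≤ s') : Dfn b n' s' P := by
  intro k m e
  obtain ⟨ψ, h1, h2, h3⟩ := h k m e
  exact ⟨ψ, h1.mono hn, h2.trans hs, h3⟩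

theorem switch (b' : Bool) (h : Dfn b n s P) : Dfn b' (n + 1) s P := by
  intro k m e
  obtain ⟨ψ, h1, h2, h3⟩ := h k m e
  exact ⟨ψ, h1.switch b', h2, h3⟩

theorem congr (h : Dfn b n s P) (hPQ : ∀ G v, P G v ↔ Q G v) : Dfn b n s Q := by
  intro k m e
  obtain ⟨ψ, h1, h2, h3⟩ := h k m e
  exact ⟨ψ, h1, h2, fun G v xs => (h3 G v xs).trans (hPQ G _)⟩

theorem rename (h : Dfn b n s P) (g : α → β) :
    Dfn b n s (fun G (v : β → G.V) => P G (fun a => v (g a))) := by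
  intro k m e
  exact h k m (fun a => e (g a))

theorem falsum : Dfn b n 1 (fun _ _ => False : Query.{u} t α) := by
  intro k m e
  exact ⟨.falsum, .falsum, le_rfl, fun _ _ _ => Iff.rfl⟩

theorem eq (x y : α) : Dfn b n 3 (fun _ v => v x = v y : Query.{u} t α) := by
  intro k m e
  exact ⟨.equal (.var (e x)) (.var (e y)), .equal _ _, le_rfl, fun G v xs => Iff.rfl⟩

theorem adj (x y : α) : Dfn b n 3 (fun G v => G.graph.Adj (v x) (v y) : Query.{u} t α) := by
  intro k m e
  refine ⟨.rel (R := (ColoredGraphRel.adj : ColoredGraphRel t 2)) (l := 2)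
    ![.var (e x), .var (e y)], .rel _ _, le_rfl, fun G v xs => Iff.rfl⟩

theorem color (c : Fin t) (x : α) : Dfn b n 2 (fun G v => v x ∈ G.color c : Query.{u} t α) := by
  intro k m e
  refine ⟨.rel (R := (ColoredGraphRel.color c : ColoredGraphRel t 1)) (l := 1)
    ![.var (e x)], .rel _ _, le_rfl, fun G v xs => Iff.rfl⟩

theorem imp (h : Dfn (!b) n s P) (h' : Dfn b n s' Q) :
    Dfn b n (s + s' + 1) (fun G v => P G v → Q G v) := by
  intro k m e
  obtain ⟨ψ, h1, h2, h3⟩ := h k m e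
  obtain ⟨ψ', h1', h2', h3'⟩ := h' k m e
  refine ⟨ψ.imp ψ', h1.imp h1', by simp only [formulaSize]; omega, fun G v xs => ?_⟩
  rw [FirstOrder.Language.BoundedFormula.realize_imp, h3, h3']

theorem all {P : Query.{u} t (Option α)} (h : Dfn false n s P) :
    Dfn false n (s + 2) (fun G v => ∀ a, P G (fun o => o.elim a v)) := by
  intro k m e
  obtain ⟨ψ, h1, h2, h3⟩ := h k (m + 1)
    (fun o => o.elim (Sum.inr (Fin.last m)) (fun a => Sum.map id Fin.castSucc (e a)))
  refine ⟨ψ.all, h1.all, by simp only [formulaSize]; omega, fun G v xs => ?_⟩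
  rw [FirstOrder.Language.BoundedFormula.realize_all]
  refine forall_congr' fun a => ?_
  rw [h3]
  have : (fun o : Option α => Sum.elim v (Fin.snoc xs a : Fin (m + 1) → G.V)
      (o.elim (Sum.inr (Fin.last m)) (fun a => Sum.map id Fin.castSucc (e a)))) =
      fun o => o.elim a (fun a => Sum.elim v xs (e a)) := by
    funext o
    cases o with
    | none => simp
    | some x =>
      simp only [Option.elim_some]
      cases e x <;> simp
  rw [this]

theorem not (h : Dfn (!b) n s P) : Dfn b n (s + 2) (fun G v => ¬ P G v) :=
  h.imp falsum

theorem not' (h : Dfn b n s P) : Dfn (!b) n (s + 2) (fun G v => ¬ P G v) :=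
  not (by rwa [Bool.not_not])

theorem and (h : Dfn b n s P) (h' : Dfn b n s' Q) :
    Dfn b n (s + s' + 5) (fun G v => P G v ∧ Q G v) :=
  ((not (imp (b := !b) (show Dfn (!!b) n s P by rwa [Bool.not_not]) h'.not')).mono le_rfl (by omega)).congr
    fun G v => by tauto

theorem or (h : Dfn b n s P) (h' : Dfn b n s' Q) :
    Dfn b n (s + s' + 3) (fun G v => P G v ∨ Q G v) :=
  ((h.not'.imp h').mono le_rfl (by omega)).congr fun G v => by tauto

theorem ex {P : Query.{u} t (Option α)} (h : Dfn true n s P) :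
    Dfn true n (s + 6) (fun G v => ∃ a, P G (fun o => o.elim a v)) :=
  (not (b := true) (all (not (b := false) h))).congr fun G v => by simp

theorem all_fintype {J : Type} [Fintype J] {P : J → Query.{u} t α} (h : ∀ j, Dfn b n s (P j)) :
    Dfn b n (Fintype.card J * (s + 5) + 3) (fun G v => ∀ j, P j G v) := by
  classical
  have key : ∀ F : Finset J, Dfn b n (F.card * (s + 5) + 3) (fun G v => ∀ j ∈ F, P j G v) := by
    intro F
    induction F using Finset.induction_on with
    | empty => exact ((falsum.imp falsum).mono le_rfl (by simp)).congr fun G v => by simp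
    | insert a F ha ih =>
      refine (((h a).and ih).mono le_rfl ?_).congr fun G v => by simp
      rw [Finset.card_insert_of_notMem ha]
      ring_nf
      omega
  exact (key Finset.univ).congr fun G v => by simp

theorem ex_fintype {J : Type} [Fintype J] {P : J → Query.{u} t α} (h : ∀ j, Dfn b n s (P j)) :
    Dfn b n (Fintype.card J * (s + 7) + 5) (fun G v => ∃ j, P j G v) :=
  (not (all_fintype fun j => (h j).not')).congr fun G v => by simp

/-- For `c = false` the query is negated, which exchanges the two quantifiers; returning to `∃`
costs the extra alternation. -/
theorem iff_bool (h : Dfn true n s P) (c : Bool) :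
    Dfn true (n + 1) (s + 2) (fun G v => P G v ↔ c = true) := by
  cases c with
  | true => exact (h.mono (by omega) (by omega)).congr fun G v => by simp
  | false => exact (h.not'.switch true).congr fun G v => by simp

theorem ex_fin {e : ℕ} {P : Query.{u} t (α ⊕ Fin e)} (h : Dfn true n s P) :
    Dfn true n (s + 6 * e) (fun G v => ∃ f : Fin e → G.V, P G (Sum.elim v f)) := by
  induction e generalizing α with
  | zero =>
    refine (h.rename (Sum.elim id Fin.elim0)).congr fun G v => ?_
    have : (fun a : α ⊕ Fin 0 => v (Sum.elim id Fin.elim0 a)) = Sum.elim v Fin.elim0 := by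
      funext a
      rcases a with a | a
      · rfl
      · exact a.elim0
    rw [this]
    refine ⟨fun h => ⟨_, h⟩, fun ⟨f, h⟩ => ?_⟩
    rwa [Subsingleton.elim f Fin.elim0] at h
  | succ e ih =>
    have h1 := h.rename (β := Option α ⊕ Fin e) (Sum.elim (fun a => Sum.inl (some a))
      (Fin.cases (Sum.inl none) fun j => Sum.inr j))
    refine ((ih h1).ex.mono le_rfl (by omega)).congr fun G v => ?_
    rw [Fin.exists_fin_succ_pi]
    refine exists_congr fun a => exists_congr fun f => ?_
    have : (fun x : α ⊕ Fin (e + 1) => (Sum.elim (fun o : Option α => o.elim a v) f)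
        (Sum.elim (fun a => Sum.inl (some a)) (Fin.cases (Sum.inl none) fun j => Sum.inr j) x)) =
        Sum.elim v (Fin.cons a f) := by
      funext x
      rcases x with x | x
      · rfl
      · refine Fin.cases ?_ (fun j => ?_) x <;> rfl
    rw [this]

theorem ex_fun {κ : Type} [Fintype κ] {P : Query.{u} t (α ⊕ κ)} (h : Dfn true n s P) :
    Dfn true n (s + 6 * Fintype.card κ) (fun G v => ∃ f : κ → G.V, P G (Sum.elim v f)) := by
  have h1 := h.rename (β := α ⊕ Fin (Fintype.card κ)) (Sum.map id (Fintype.equivFin κ))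
  refine h1.ex_fin.congr fun G v => ?_
  have : ∀ f : Fin (Fintype.card κ) → G.V,
      (fun a : α ⊕ κ => Sum.elim v f (Sum.map id (Fintype.equivFin κ) a)) =
      Sum.elim v (fun a => f (Fintype.equivFin κ a)) := by
    intro f
    funext a
    rcases a with a | a <;> rfl
  simp only [this]
  constructor
  · rintro ⟨f, h⟩
    exact ⟨_, h⟩
  · rintro ⟨f, h⟩
    exact ⟨fun j => f ((Fintype.equivFin κ).symm j), by simpa using h⟩

end Dfn

/-! ### Definable sets and structures -/

/-- A set of vertices that depends on a tuple of vertices. -/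
abbrev SetQuery (t : ℕ) (α : Type) := ∀ G : ColoredGraph.{u} t, (α → G.V) → Set G.V

/-- Definability of a set with parameters. -/
def DfnSet {t : ℕ} {α : Type} (b : Bool) (n s : ℕ) (X : SetQuery.{u} t α) : Prop :=
  Dfn b n s (fun G (v : Option α → G.V) => v none ∈ X G (fun a => v (some a)))

namespace DfnSet

variable {t : ℕ} {α β : Type} {b : Bool} {n s : ℕ} {X : SetQuery.{u} t α}

theorem mono {n' s' : ℕ} (h : DfnSet b n s X) (hn : n ≤ n') (hs : s ≤ s') : DfnSet b n' s' X :=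
  Dfn.mono h hn hs

theorem mem (h : DfnSet b n s X) (g : α → β) (y : β) :
    Dfn b n s (fun G (v : β → G.V) => v y ∈ X G (fun a => v (g a))) :=
  Dfn.rename h (fun o => o.elim y g)

theorem rename (h : DfnSet b n s X) (g : α → β) :
    DfnSet b n s (fun G (v : β → G.V) => X G (fun a => v (g a))) :=
  h.mem (fun a => some (g a)) none

/-- A ball is described by existentially quantifying the vertices of a walk, with membership in `X`
existential as well, so no alternation arises and the size is linear in the radius. -/
theorem nbhd (h : DfnSet true 0 s X) (x : α) (r : ℕ) :
    DfnSet true 0 ((r + 1) * (s + 25)) (fun G v => nbhd G.graph (X G v) {v x} r) := by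
  induction r with
  | zero =>
    exact (((Dfn.eq none (some x)).and (h.mem some none)).mono le_rfl (by omega)).congr
      fun G v => Iff.rfl
  | succ r ih =>
    have h1 := (ih.mem (fun a => some (some a)) (none : Option (Option α))).and
      ((Dfn.eq none (some none)).or (Dfn.adj none (some none)))
    refine (((h.mem some none).and h1.ex).mono le_rfl ?_).congr fun G v => Iff.rfl
    ring_nf
    omega

theorem diff {κ : Type} [Fintype κ] (h : DfnSet b n s X) (σ : κ → α) :
    DfnSet b n (s + 10 * Fintype.card κ + 8)
      (fun G v => X G v \ Set.range fun k => v (σ k)) := by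
  have h1 := Dfn.all_fintype (b := b) (n := n) (J := κ)
    fun k => (Dfn.eq (t := t) (some (σ k)) (none : Option α)).not
  refine (((h.mem some none).and h1).mono le_rfl (by omega)).congr fun G v => ?_
  simp

end DfnSet

/-- Splitter's winning the `d`-round game is definable. -/
theorem exists_dfn_splitterWins (t d : ℕ) : ∃ h, ∀ (x R n : ℕ) (α : Type) (X : SetQuery.{u} t α),
    R ≤ x → n ≤ x → DfnSet true 0 x X →
      Dfn false (2 * d) (tower h x) (fun G v => SplitterWins G.graph R n d (X G v)) := by
  induction d with
  | zero =>
    obtain ⟨h, hh⟩ : ElementarilyBounded fun x => x + 4 := .add .id (.const 4)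
    refine ⟨h, fun x R n α X _ _ hX => ?_⟩
    exact ((Dfn.all (Dfn.not (b := false) hX)).mono le_rfl (hh x)).congr fun G v => Iff.rfl
  | succ d ih =>
    obtain ⟨h, hh⟩ := ih
    obtain ⟨h', hh'⟩ : ElementarilyBounded fun x => tower h ((x + 1) * (x + 25) + 10 * x + 8) +
        (x * ((x + 1) * (x + 25) + 5) + 3) + (7 * x + 10) :=
      .add (.add (.tower_comp _ (.add (.add (.mul (.add .id (.const 1)) (.add .id (.const 25)))
        (.mul (.const 10) .id)) (.const 8)))
        (.add (.mul .id (.add (.mul (.add .id (.const 1)) (.add .id (.const 25))) (.const 5)))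
        (.const 3))) (.add (.mul (.const 7) .id) (.const 10))
    refine ⟨h', fun x R n α X hR hn hX => ?_⟩
    have hle : (R + 1) * (x + 25) ≤ (x + 1) * (x + 25) := Nat.mul_le_mul_right _ (by omega)
    have hball := (((hX.rename (some : α → Option α)).nbhd none R).mono le_rfl hle).rename
      (Sum.inl : Option α → Option α ⊕ Fin n)
    have hdel := hball.diff (Sum.inr : Fin n → Option α ⊕ Fin n)
    simp only [Fintype.card_fin] at hdel
    have hmono : (x + 1) * (x + 25) + 10 * n + 8 ≤ (x + 1) * (x + 25) + 10 * x + 8 := by omega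
    have hx : x ≤ (x + 1) * (x + 25) + 10 * x + 8 := by omega
    have h1 := hh _ R n _ _ (hR.trans hx) (hn.trans hx) (hdel.mono le_rfl hmono)
    -- One round `∀ x ∃ s` costs two alternations: the statement for the remaining rounds starts
    -- with `∀`, so one switch places it under `∃ s` and a second one places the result under `∀ x`.
    -- The premise of the implication is existential, hence universal once negated, and adds
    -- nothing.
    have h2 := Dfn.all_fintype (J := Fin n) (b := true) (n := 2 * d + 1) (fun j =>
      (hball.mem id (Sum.inr j)).mono (n' := 2 * d + 1) (by omega) le_rfl)
    have h3 := (h2.and (h1.switch true)).ex_fun.switch false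
    have h4 := (Dfn.imp (b := false) ((hX.mem (some : α → Option α) none).mono
      (n' := 2 * d + 1 + 1) (by omega) le_rfl) h3).all
    refine (h4.mono (by omega) ?_).congr fun G v => Iff.rfl
    refine le_trans ?_ (hh' x)
    simp only [Fintype.card_fin]
    have e1 : n * ((x + 1) * (x + 25) + 5) ≤ x * ((x + 1) * (x + 25) + 5) :=
      Nat.mul_le_mul_right _ hn
    omega

/-- A coloured graph defined with parameters in a coloured graph. -/
structure WorldQuery (t : ℕ) (ι α : Type) where
  /-- the vertex set -/
  dom : SetQuery.{u} t α
  /-- the colours -/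
  col : ι → SetQuery.{u} t α

namespace WorldQuery

variable {t : ℕ} {ι α κ : Type}

/-- The structure defined by the parameters `v` in `G`. -/
def eval (w : WorldQuery.{u} t ι α) (G : ColoredGraph.{u} t) (v : α → G.V) : World ι G.V where
  graph := G.graph
  col := fun i => w.col i G v
  dom := w.dom G v

/-- The vertex set is existential, the colours are quantifier-free. -/
structure Definable (w : WorldQuery.{u} t ι α) (s : ℕ) : Prop where
  dom : DfnSet true 0 s w.dom
  col : ∀ i b, DfnSet b 0 s (w.col i)

theorem Definable.mono {w : WorldQuery.{u} t ι α} {s s' : ℕ} (h : w.Definable s) (hs : s ≤ s') :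
    w.Definable s' :=
  ⟨h.dom.mono le_rfl hs, fun i b => (h.col i b).mono le_rfl hs⟩

/-- Deletion of parameters, with new colours for the adjacency to them. -/
def delete (w : WorldQuery.{u} t ι α) (σ : κ → α) : WorldQuery.{u} t (ι ⊕ κ) α where
  dom := fun G v => w.dom G v \ Set.range fun k => v (σ k)
  col := Sum.elim w.col fun k G v => {y | G.graph.Adj (v (σ k)) y}

theorem eval_delete (w : WorldQuery.{u} t ι α) (σ : κ → α) (G : ColoredGraph.{u} t)
    (v : α → G.V) : (w.delete σ).eval G v = (w.eval G v).delete fun k => v (σ k) := by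
  have : (fun i => (w.delete σ).col i G v) =
      Sum.elim (fun i => w.col i G v) fun k => {y | G.graph.Adj (v (σ k)) y} := by
    funext i
    cases i <;> rfl
  simp only [eval, World.delete, this]
  rfl

theorem Definable.delete [Fintype κ] {w : WorldQuery.{u} t ι α} {s : ℕ} (h : w.Definable s)
    (σ : κ → α) : (w.delete σ).Definable (s + 10 * Fintype.card κ + 8) := by
  refine ⟨h.dom.diff σ, fun i b => ?_⟩
  rcases i with i | k
  · exact (h.col i b).mono le_rfl (by omega)
  · exact (Dfn.adj (t := t) (some (σ k)) none).mono le_rfl (by omega)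

/-- The structure on the ball of radius `r` around the additional parameter `none`. -/
def ball (w : WorldQuery.{u} t ι α) (n r : ℕ) : WorldQuery.{u} t ι (α ⊕ Option (Fin n)) where
  dom := fun G v => nbhd G.graph (w.dom G fun a => v (Sum.inl a)) {v (Sum.inr none)} r
  col := fun i G v => w.col i G fun a => v (Sum.inl a)

theorem Definable.ball {w : WorldQuery.{u} t ι α} {s : ℕ} (h : w.Definable s) (n r : ℕ) :
    (w.ball n r).Definable ((r + 1) * (s + 25)) := by
  refine ⟨(h.dom.rename (Sum.inl : α → α ⊕ Option (Fin n))).nbhd (Sum.inr none) r, fun i b => ?_⟩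
  refine ((h.col i b).rename Sum.inl).mono le_rfl ?_
  nlinarith

/-- Agreement on the queries `Φ` implies the equivalence of the structures, for `q` rounds, among
the structures on which Splitter wins the `d`-round game. -/
def Determines (w : WorldQuery.{u} t ι α) (R n d q : ℕ) {J : Type} (Φ : J → Query.{u} t α) :
    Prop :=
  ∀ (G G' : ColoredGraph.{u} t) (v : α → G.V) (v' : α → G'.V),
    SplitterWins G.graph R n d (w.dom G v) → SplitterWins G'.graph R n d (w.dom G' v') →
    (∀ j, Φ j G v ↔ Φ j G' v') → EF (w.eval G v) (w.eval G' v') q ∅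

/-- The same, for the structures with the parameters `σ`, which are deleted before the game. -/
def DeterminesTuple (w : WorldQuery.{u} t ι α) (σ : κ → α) (R n d q : ℕ) {J : Type}
    (Φ : J → Query.{u} t α) : Prop :=
  ∀ (G G' : ColoredGraph.{u} t) (v : α → G.V) (v' : α → G'.V),
    (∀ k, v (σ k) ∈ w.dom G v) → (∀ k, v' (σ k) ∈ w.dom G' v') →
    SplitterWins G.graph R n d (w.dom G v \ Set.range fun k => v (σ k)) →
    SplitterWins G'.graph R n d (w.dom G' v' \ Set.range fun k => v' (σ k)) →
    (∀ j, Φ j G v ↔ Φ j G' v') →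
    EF (w.eval G v) (w.eval G' v') q (Set.range fun k => (v (σ k), v' (σ k)))

/-- The queries for the atomic type of the tuple `σ`. -/
def atomic (w : WorldQuery.{u} t ι α) (σ : κ → α) :
    (κ × κ) ⊕ (κ × κ) ⊕ (ι × κ) → Query.{u} t α
  | .inl p => fun _ v => v (σ p.1) = v (σ p.2)
  | .inr (.inl p) => fun G v => G.graph.Adj (v (σ p.1)) (v (σ p.2))
  | .inr (.inr p) => fun G v => v (σ p.2) ∈ w.col p.1 G v

theorem dfn_atomic {w : WorldQuery.{u} t ι α} {s : ℕ} (h : w.Definable s) (σ : κ → α) {b : Bool}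
    (j : (κ × κ) ⊕ (κ × κ) ⊕ (ι × κ)) : Dfn b 0 (s + 3) (w.atomic σ j) := by
  rcases j with p | p | p
  · exact (Dfn.eq _ _).mono le_rfl (by omega)
  · exact (Dfn.adj _ _).mono le_rfl (by omega)
  · exact ((h.col p.1 b).mem id (σ p.2)).mono le_rfl (by omega)

/-- After the deletion, the colours remember the adjacency to the tuple. What is lost is the
isomorphism type of the tuple itself, which the atomic queries supply. -/
theorem Determines.tuple {w : WorldQuery.{u} t ι α} {σ : κ → α} {R n d q : ℕ} {J : Type}
    {Φ : J → Query.{u} t α} (h : (w.delete σ).Determines R n d q Φ) :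
    w.DeterminesTuple σ R n d q (Sum.elim Φ (w.atomic σ)) := by
  intro G G' v v' hv hv' hw hw' hag
  have h1 := h G G' v v' hw hw' (fun j => hag (Sum.inl j))
  rw [eval_delete, eval_delete] at h1
  have h2 := EF.of_delete hv hv' ?_ h1 (by simp)
  · rwa [Set.empty_union] at h2
  · rintro _ ⟨k, rfl⟩
    refine ⟨fun i => hag (.inr (.inr (.inr (i, k)))), ?_⟩
    rintro _ ⟨l, rfl⟩
    exact ⟨hag (.inr (.inl (k, l))), hag (.inr (.inr (.inl (k, l))))⟩

/-- The vertices of the tuple lie in the ball around its first vertex, Splitter wins the `d`-round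
game after their deletion, and the truth values of `Φ` are `χ`. -/
def localQuery (w : WorldQuery.{u} t ι α) (R n d r : ℕ) {J : Type}
    (Φ : J → Query.{u} t (α ⊕ Option (Fin n))) (χ : J → Bool) :
    Query.{u} t (α ⊕ Option (Fin n)) := fun G v =>
  (∀ k, v (Sum.inr k) ∈ (w.ball n r).dom G v) ∧
    SplitterWins G.graph R n d ((w.ball n r).dom G v \ Set.range fun k => v (Sum.inr k)) ∧
    ∀ j, (Φ j G v ↔ χ j = true)

/-- There are `e` vertices, pairwise far apart, of the local types `χ`. -/
def scatterQuery (w : WorldQuery.{u} t ι α) (R n d r : ℕ) {J : Type}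
    (Φ : J → Query.{u} t (α ⊕ Option (Fin n))) {e : ℕ} (χ : Fin e → J → Bool) :
    Query.{u} t α := fun G v =>
  ∃ f : Fin e × Option (Fin n) → G.V,
    (∀ p : Fin e × Fin e, p.1 ≠ p.2 →
      f (p.2, none) ∉ nbhd G.graph (w.dom G v) {f (p.1, none)} (4 * r + 2)) ∧
    ∀ j, w.localQuery R n d r Φ (χ j) G (Sum.elim v fun k => f (j, k))

/-- Transfer of the scatter queries gives the transfer of scattered tuples. -/
theorem scatterTransfer {w : WorldQuery.{u} t ι α} {R n d q : ℕ} {J : Fin q → Type}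
    {Φ : ∀ i, J i → Query.{u} t (α ⊕ Option (Fin n))} (hR : localRadius q ≤ R)
    (hΦ : ∀ i : Fin q, (w.ball n (localRadius i)).DeterminesTuple Sum.inr R n d (localRank q q)
      (Φ i)) {G G' : ColoredGraph.{u} t} {v : α → G.V} {v' : α → G'.V}
    (hw : SplitterWins G.graph R n (d + 1) (w.dom G v))
    (h : ∀ (i : Fin q) (e : Fin (q + 1)) (χ : Fin e → J i → Bool),
      w.scatterQuery R n d (localRadius i) (Φ i) χ G v →
        w.scatterQuery R n d (localRadius i) (Φ i) χ G' v') :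
    ScatterTransfer (w.eval G v) (w.eval G' v') q := by
  classical
  intro i hi e he x hx
  have hri : localRadius i ≤ R := (localRadius_mono hi.le).trans hR
  choose s hs hsw using fun j => hw (x j) (hx.1 j)
  -- The index `none` is the scattered vertex, the others are Splitter's batch for it. Batch
  -- vertices outside the ball of the smaller radius are replaced by the centre.
  let f : Fin e × Option (Fin n) → G.V := fun p => p.2.elim (x p.1) fun m =>
    if s p.1 m ∈ nbhd G.graph (w.dom G v) {x p.1} (localRadius i) then s p.1 m else x p.1
  let χ : Fin e → J ⟨i, hi⟩ → Bool := fun j a =>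
    decide (Φ ⟨i, hi⟩ a G (Sum.elim v fun k => f (j, k)))
  have hloc : ∀ j, w.localQuery R n d (localRadius i) (Φ ⟨i, hi⟩) (χ j) G
      (Sum.elim v fun k => f (j, k)) := by
    refine fun j => ⟨fun k => ?_, (hsw j).mono ?_, fun a => ?_⟩
    · change f (j, k) ∈ nbhd G.graph (w.dom G v) {x j} (localRadius i)
      cases k with
      | none => exact mem_nbhd_self (hx.1 j) _
      | some m =>
        simp only [f, Option.elim_some]
        split_ifs with hm
        · exact hm
        · exact mem_nbhd_self (hx.1 j) _
    · rintro y ⟨hy, hyr⟩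
      refine ⟨nbhd_mono_radius hri hy, ?_⟩
      rintro ⟨m, rfl⟩
      refine hyr ⟨some m, ?_⟩
      change (if s j m ∈ nbhd G.graph (w.dom G v) {x j} (localRadius i) then s j m else x j) = s j m
      exact if_pos hy
    · simp [χ]
  obtain ⟨f', hf', hl⟩ := h ⟨i, hi⟩ ⟨e, by omega⟩ χ ⟨f, fun p hp => hx.2 p.1 p.2 hp, hloc⟩
  refine ⟨fun j => f' (j, none), ⟨fun j => ?_, fun j l hjl => hf' (j, l) hjl⟩, fun j => ?_⟩
  · exact nbhd_subset _ ((hl j).1 none)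
  · have := hΦ ⟨i, hi⟩ G G' _ _ (hloc j).1 (hl j).1 (hloc j).2.1 (hl j).2.1
      (fun a => ((hloc j).2.2 a).trans ((hl j).2.2 a).symm)
    exact (this.of_le (localRank_mono q hi.le)).mono (Set.singleton_subset_iff.2 ⟨none, rfl⟩)

end WorldQuery

/-! ### Definable types of bounded size -/

/-- Structures on which Splitter wins the `d`-round game have, for `q` rounds, types given by
few and short queries of low alternation rank. -/
def HasTypes (t d h : ℕ) : Prop :=
  ∀ (x q R n : ℕ) (ι α : Type) [Fintype ι] (w : WorldQuery.{u} t ι α), q ≤ x → R ≤ x → n ≤ x →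
    Fintype.card ι ≤ x → w.Definable x → tower h q ≤ R →
    ∃ (J : Type) (_ : Fintype J) (Φ : J → Query.{u} t α), Fintype.card J ≤ tower h x ∧
      (∀ j, Dfn true (2 * d - 1) (tower h x) (Φ j)) ∧ w.Determines R n d q Φ

/-- The same for structures with a distinguished tuple. -/
def HasTupleTypes (t d h : ℕ) : Prop :=
  ∀ (x q R n : ℕ) (ι α κ : Type) [Fintype ι] [Fintype κ] (w : WorldQuery.{u} t ι α) (σ : κ → α),
    q ≤ x → R ≤ x → n ≤ x → Fintype.card ι ≤ x → Fintype.card κ ≤ x → w.Definable x →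
    tower h q ≤ R →
    ∃ (J : Type) (_ : Fintype J) (Φ : J → Query.{u} t α), Fintype.card J ≤ tower h x ∧
      (∀ j, Dfn true (2 * d - 1) (tower h x) (Φ j)) ∧ w.DeterminesTuple σ R n d q Φ

/-- The tuple is deleted and the types of the remainder are used, together with the atomic type of
the tuple. -/
theorem HasTypes.tuple {t d h : ℕ} (H : HasTypes.{u} t d h) : ∃ h', HasTupleTypes.{u} t d h' := by
  obtain ⟨h', hh'⟩ : ElementarilyBounded fun x => tower h (11 * x + 8) + (3 * (x * x) + x + 3) :=
    .add (.tower_comp _ (.add (.mul (.const 11) .id) (.const 8)))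
      (.add (.add (.mul (.const 3) (.mul .id .id)) .id) (.const 3))
  -- A larger tower height only strengthens the assumption on `R` and weakens the bounds to be
  -- shown, so a maximum serves both.
  refine ⟨max h h', fun x q R n ι α κ _ _ w σ hq hR hn hι hκ hw htow => ?_⟩
  have hh : tower h (11 * x + 8) + (3 * (x * x) + x + 3) ≤ tower (max h h') x :=
    (hh' x).trans (tower_le_tower (le_max_right _ _) x)
  -- Deletion raises the defining size from `x` to at most `x + 10 * x + 8`, and the number of
  -- colours to at most `2 * x`.
  obtain ⟨J, hJ, Φ, hcard, hdfn, hdet⟩ := H (11 * x + 8) q R n (ι ⊕ κ) α (w.delete σ)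
    (by omega) (by omega) (by omega) (by simp only [Fintype.card_sum]; omega)
    ((hw.delete σ).mono (by omega)) ((tower_le_tower (le_max_left _ _) q).trans htow)
  refine ⟨_, inferInstance, _, ?_, ?_, hdet.tuple⟩
  · simp only [Fintype.card_sum, Fintype.card_prod]
    have h1 := Nat.mul_le_mul hκ hκ
    have h2 := Nat.mul_le_mul hι hκ
    omega
  · rintro (j | j)
    · exact (hdfn j).mono le_rfl (by omega)
    · exact (WorldQuery.dfn_atomic hw σ j).mono (by omega) (by omega)

/-- The dominant part is Splitter's win: it starts with `∀` and has bound `2 * d`, hence `2 * d + 1`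
below `∃`. The type queries, even when negated, stay below that. -/
theorem WorldQuery.dfn_localQuery {t : ℕ} {ι α : Type} {w : WorldQuery.{u} t ι α}
    {R n d r B S N D : ℕ} {J : Type} [Fintype J] {Φ : J → Query.{u} t (α ⊕ Option (Fin n))}
    (hw : (w.ball n r).Definable B)
    (hwin : Dfn false (2 * d) D (fun G v => SplitterWins G.graph R n d
      (((w.ball n r).delete Sum.inr).dom G v)))
    (hJ : Fintype.card J ≤ N) (hΦ : ∀ j, Dfn true (2 * d - 1) S (Φ j)) (χ : J → Bool) :
    Dfn true (2 * d + 1) ((n + 1) * (B + 5) + D + N * (S + 7) + 16)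
      (w.localQuery R n d r Φ χ) := by
  have h1 := Dfn.all_fintype (J := Option (Fin n)) (b := true) (n := 2 * d + 1)
    (fun k => (hw.dom.mem id (Sum.inr k)).mono (Nat.zero_le _) le_rfl)
  have h2 := hwin.switch true
  have h3 : ∀ j, Dfn true (2 * d + 1) (S + 2) (fun G v => Φ j G v ↔ χ j = true) :=
    fun j => ((hΦ j).iff_bool (χ j)).mono (by omega) le_rfl
  have h4 := h1.and (h2.and (Dfn.all_fintype h3))
  refine (h4.mono le_rfl ?_).congr fun G v => Iff.rfl
  simp only [Fintype.card_option, Fintype.card_fin]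
  have := Nat.mul_le_mul_right (S + 7) hJ
  have e : Fintype.card J * (S + 2 + 5) = Fintype.card J * (S + 7) := by ring
  omega

/-- The outer block of existential quantifiers is free, since the local queries are already counted
below `∃`. Being far apart is universal and costs one alternation. -/
theorem WorldQuery.dfn_scatterQuery {t : ℕ} {ι α : Type} {w : WorldQuery.{u} t ι α}
    {R n d r s S : ℕ} {J : Type} {Φ : J → Query.{u} t (α ⊕ Option (Fin n))}
    (hw : w.Definable s) {e : ℕ} {χ : Fin e → J → Bool}
    (hloc : ∀ j, Dfn true (2 * d + 1) S (w.localQuery R n d r Φ (χ j))) :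
    Dfn true (2 * d + 1)
      (e * e * ((4 * r + 3) * (s + 25) + 10) + e * (S + 5) + 6 * (e * (n + 1)) + 11)
      (w.scatterQuery R n d r Φ χ) := by
  have h1 : ∀ p : Fin e × Fin e, Dfn true (2 * d + 1) ((4 * r + 3) * (s + 25) + 5)
      (fun G (v : α ⊕ (Fin e × Option (Fin n)) → G.V) => p.1 ≠ p.2 → v (Sum.inr (p.2, none)) ∉
        nbhd G.graph (w.dom G fun a => v (Sum.inl a)) {v (Sum.inr (p.1, none))} (4 * r + 2)) := by
    intro p
    by_cases hp : p.1 = p.2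
    · exact ((Dfn.falsum.imp Dfn.falsum).mono le_rfl (by omega)).congr fun G v => by simp [hp]
    · have h := (hw.dom.rename (Sum.inl : α → α ⊕ (Fin e × Option (Fin n)))).nbhd
        (Sum.inr (p.1, none)) (4 * r + 2)
      exact (((h.mem id (Sum.inr (p.2, none))).not'.switch true).mono (by omega)
        (Nat.add_le_add_left (by omega) _)).congr fun G v => by simp [hp]
  have h2 : ∀ j, Dfn true (2 * d + 1) S
      (fun G (v : α ⊕ (Fin e × Option (Fin n)) → G.V) => w.localQuery R n d r Φ (χ j) G
        (Sum.elim (fun a => v (Sum.inl a)) fun k => v (Sum.inr (j, k)))) := by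
    intro j
    refine ((hloc j).rename (Sum.map id fun k => (j, k))).congr fun G v => ?_
    have : (fun a : α ⊕ Option (Fin n) => v (Sum.map id (fun k => (j, k)) a)) =
        Sum.elim (fun a => v (Sum.inl a)) fun k => v (Sum.inr (j, k)) := by
      funext a
      rcases a with a | a <;> rfl
    rw [this]
  have h3 := ((Dfn.all_fintype h1).and (Dfn.all_fintype h2)).ex_fun
  refine (h3.mono le_rfl ?_).congr fun G v => Iff.rfl
  simp only [Fintype.card_prod, Fintype.card_option, Fintype.card_fin]
  have : (4 * r + 3) * (s + 25) + 5 + 5 = (4 * r + 3) * (s + 25) + 10 := by ring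
  rw [this]
  omega

/-- Passing from `d` to `d + 1` replaces `q` by `localRank q q`, which is only exponential in `q`.
So each level of the induction raises the required tower height for `R` by a constant. -/
theorem elementarilyBounded_localRank (h : ℕ) :
    ElementarilyBounded fun q => tower h (localRank q q) + localRadius q := by
  have h7 : ElementarilyBounded fun q => q * (q + 7 ^ (q + 1) + 10) :=
    .mul .id (.add (.add .id (.pow (.const 7) (.add .id (.const 1)))) (.const 10))
  refine (ElementarilyBounded.add (.tower_comp h h7) (.pow (.const 7) .id)).of_le fun q => ?_
  exact Nat.add_le_add (tower_mono h (localRank_le q q)) (by have := localRadius_le q; omega)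

theorem card_sigma_sigma_le {q x N : ℕ} (J : Fin q → Type) [∀ i, Fintype (J i)]
    [∀ i, DecidableEq (J i)]
    (hJ : ∀ i, Fintype.card (J i) ≤ N) (hq : q ≤ x) :
    Fintype.card (Σ i : Fin q, Σ e : Fin (q + 1), Fin e → J i → Bool) ≤
      x * ((x + 1) * (2 ^ N) ^ x) := by
  have hb : ∀ (i : Fin q) (e : Fin (q + 1)),
      Fintype.card (Fin e → J i → Bool) ≤ (2 ^ N) ^ x := by
    intro i e
    simp only [Fintype.card_fun, Fintype.card_bool, Fintype.card_fin]
    exact (Nat.pow_le_pow_left (Nat.pow_le_pow_right (by norm_num) (hJ i)) _).trans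
      (Nat.pow_le_pow_right (Nat.two_pow_pos N) (by omega))
  rw [Fintype.card_sigma]
  calc ∑ i : Fin q, Fintype.card (Σ e : Fin (q + 1), Fin e → J i → Bool)
      ≤ ∑ _i : Fin q, (x + 1) * (2 ^ N) ^ x := by
        refine Finset.sum_le_sum fun i _ => ?_
        rw [Fintype.card_sigma]
        refine (Finset.sum_le_sum fun e _ => hb i e).trans ?_
        simp only [Finset.sum_const, Finset.card_univ, Fintype.card_fin, smul_eq_mul]
        exact Nat.mul_le_mul_right _ (by omega)
    _ = q * ((x + 1) * (2 ^ N) ^ x) := by simp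
    _ ≤ x * ((x + 1) * (2 ^ N) ^ x) := Nat.mul_le_mul_right _ hq

/-- The queries are the scatter queries for all numbers `i` of remaining rounds, all lengths up to
`q`, and all choices of local types. Agreement on them gives the transfer of scattered tuples in
both directions, and locality does the rest. -/
theorem HasTupleTypes.succ {t d h : ℕ} (H : HasTupleTypes.{u} t d h) :
    ∃ h', HasTypes.{u} t (d + 1) h' := by
  classical
  obtain ⟨h₁, hh₁⟩ := elementarilyBounded_localRank h
  obtain ⟨hw, hhw⟩ := exists_dfn_splitterWins.{u} t d
  have eB : ElementarilyBounded fun x => (x + 1) * (x + 25) :=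
    .mul (.add .id (.const 1)) (.add .id (.const 25))
  have eN : ElementarilyBounded fun x => tower h ((x + 1) * (x + 25)) := .tower_comp h eB
  have eD : ElementarilyBounded fun x => tower hw ((x + 1) * (x + 25) + 10 * (x + 1) + 8) :=
    .tower_comp hw (.add (.add eB (.mul (.const 10) (.add .id (.const 1)))) (.const 8))
  have eS : ElementarilyBounded fun x => (x + 1) * ((x + 1) * (x + 25) + 5) +
      tower hw ((x + 1) * (x + 25) + 10 * (x + 1) + 8) +
      tower h ((x + 1) * (x + 25)) * (tower h ((x + 1) * (x + 25)) + 7) + 16 :=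
    .add (.add (.add (.mul (.add .id (.const 1)) (.add eB (.const 5))) eD)
      (.mul eN (.add eN (.const 7)))) (.const 16)
  obtain ⟨h₂, hh₂⟩ : ElementarilyBounded fun x => x * x * ((4 * x + 3) * (x + 25) + 10) +
      x * ((x + 1) * ((x + 1) * (x + 25) + 5) +
      tower hw ((x + 1) * (x + 25) + 10 * (x + 1) + 8) +
      tower h ((x + 1) * (x + 25)) * (tower h ((x + 1) * (x + 25)) + 7) + 16 + 5) +
      6 * (x * (x + 1)) + 11 :=
    .add (.add (.add (.mul (.mul .id .id) (.add (.mul (.add (.mul (.const 4) .id) (.const 3))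
      (.add .id (.const 25))) (.const 10))) (.mul .id (.add eS (.const 5))))
      (.mul (.const 6) (.mul .id (.add .id (.const 1))))) (.const 11)
  obtain ⟨h₃, hh₃⟩ : ElementarilyBounded fun x =>
      x * ((x + 1) * (2 ^ tower h ((x + 1) * (x + 25))) ^ x) :=
    .mul .id (.mul (.add .id (.const 1)) (.pow (.pow (.const 2) eN) .id))
  refine ⟨max h₁ (max h₂ h₃), fun x q R n ι α _ w hq hR hn hι hdw htow => ?_⟩
  have hloc : tower h (localRank q q) + localRadius q ≤ R :=
    ((hh₁ q).trans (tower_le_tower (le_max_left _ _) q)).trans htow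
  have hrad : localRadius q ≤ R := by omega
  have hrank : tower h (localRank q q) ≤ R := by omega
  have hrank' := self_le_tower h (localRank q q)
  have hB : x + 1 ≤ (x + 1) * (x + 25) := Nat.le_mul_of_pos_right _ (by omega)
  have hball : ∀ i : Fin q, (w.ball n (localRadius i)).Definable ((x + 1) * (x + 25)) := by
    intro i
    have := localRadius_mono i.2.le
    exact (hdw.ball n _).mono (Nat.mul_le_mul_right _ (by omega))
  -- The types used are those of the balls with the centre and Splitter's batch as the distinguished
  -- tuple. The number of rounds `localRank q q` suffices for every `i`.
  choose J hJ Φ hcard hdfn hdet using fun i : Fin q =>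
    H ((x + 1) * (x + 25)) (localRank q q) R n ι (α ⊕ Option (Fin n)) (Option (Fin n))
      (w.ball n (localRadius i)) Sum.inr (by omega) (by omega) (by omega) (by omega)
      (by simp only [Fintype.card_option, Fintype.card_fin]; omega) (hball i) hrank
  refine ⟨Σ i : Fin q, Σ e : Fin (q + 1), Fin e → J i → Bool, inferInstance,
    fun z => w.scatterQuery R n d (localRadius z.1) (Φ z.1) z.2.2, ?_, ?_, ?_⟩
  · refine ((card_sigma_sigma_le J hcard hq).trans (hh₃ x)).trans (tower_le_tower ?_ x)
    exact (le_max_right _ _).trans (le_max_right _ _)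
  · rintro ⟨i, e, χ⟩
    have hwin := hhw ((x + 1) * (x + 25) + 10 * (x + 1) + 8) R n _ _ (by omega) (by omega)
      (((hball i).delete Sum.inr).dom.mono le_rfl
        (by simp only [Fintype.card_option, Fintype.card_fin]; omega))
    have h1 := WorldQuery.dfn_scatterQuery hdw fun j =>
      WorldQuery.dfn_localQuery (hball i) hwin (hcard i) (hdfn i) (χ j)
    refine h1.mono (by omega) (le_trans ?_ ((hh₂ x).trans (tower_le_tower ?_ x)))
    · have he : (e : ℕ) ≤ x := by omega
      have hr : localRadius i ≤ x := (localRadius_mono i.2.le).trans (hrad.trans hR)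
      dsimp only
      gcongr
    · exact (le_max_left _ _).trans (le_max_right _ _)
  · intro G G' v v' hwin hwin' hag
    exact ef_of_scatterTransfer
      (WorldQuery.scatterTransfer hrad hdet hwin fun i e χ => (hag ⟨i, e, χ⟩).1)
      (WorldQuery.scatterTransfer hrad hdet hwin' fun i e χ => (hag ⟨i, e, χ⟩).2)

/-- If Splitter wins in `0` rounds, the structure is empty and no query is needed. -/
theorem exists_hasTypes (t d : ℕ) : ∃ h, HasTypes.{u} t d h := by
  induction d with
  | zero =>
    refine ⟨0, fun x q R n ι α _ w _ _ _ _ _ _ => ⟨Empty, inferInstance, fun j => j.elim, by simp,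
      fun j => j.elim, fun G G' v v' hw hw' _ => ?_⟩⟩
    exact EF.of_dom_empty (Set.eq_empty_of_forall_notMem hw) (Set.eq_empty_of_forall_notMem hw')
      (fun p hp => hp.elim)
  | succ d ih =>
    obtain ⟨h, hh⟩ := ih
    obtain ⟨h', hh'⟩ := hh.tuple
    exact hh'.succ

/-! ### Formulas and games -/

/-- A coloured graph, with all its vertices. -/
def ColoredGraph.world {t : ℕ} (G : ColoredGraph.{u} t) : World (Fin t) G.V where
  graph := G.graph
  col := G.color
  dom := Set.univ

section realize

variable {t k m : ℕ}

theorem card_varFinsetLeft_le (τ : (coloredGraphLang t).Term (Fin k ⊕ Fin m)) :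
    τ.varFinsetLeft.card ≤ 1 := by
  rcases τ with (x | x) | f
  · simp [FirstOrder.Language.Term.varFinsetLeft]
  · simp [FirstOrder.Language.Term.varFinsetLeft]
  · exact Empty.elim f

theorem card_freeVarFinset_le (φ : (coloredGraphLang t).BoundedFormula (Fin k) m) :
    φ.freeVarFinset.card ≤ formulaSize φ := by
  induction φ with
  | falsum => simp [FirstOrder.Language.BoundedFormula.freeVarFinset]
  | equal t₁ t₂ =>
    have h1 := card_varFinsetLeft_le t₁
    have h2 := card_varFinsetLeft_le t₂
    refine (Finset.card_union_le _ _).trans ?_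
    simp only [formulaSize]
    omega
  | rel R ts =>
    refine (Finset.card_biUnion_le_card_mul _ _ 1 fun i _ => card_varFinsetLeft_le _).trans ?_
    simp [formulaSize]
  | imp φ ψ h1 h2 =>
    refine (Finset.card_union_le _ _).trans ?_
    simp only [formulaSize]
    omega
  | all φ h =>
    simp only [formulaSize]
    exact h.trans (Nat.le_add_right _ _)

theorem realize_term_mem {G G' : ColoredGraph.{u} t} {ρ : Set (G.V × G'.V)} {v : Fin k → G.V}
    {v' : Fin k → G'.V} {xs : Fin m → G.V} {xs' : Fin m → G'.V} (hx : ∀ i, (xs i, xs' i) ∈ ρ)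
    (τ : (coloredGraphLang t).Term (Fin k ⊕ Fin m))
    (hv : ∀ a ∈ τ.varFinsetLeft, (v a, v' a) ∈ ρ) :
    (τ.realize (Sum.elim v xs), τ.realize (Sum.elim v' xs')) ∈ ρ := by
  rcases τ with (x | x) | f
  · exact hv x (by simp [FirstOrder.Language.Term.varFinsetLeft])
  · exact hx x
  · exact Empty.elim f

/-- Equivalent positions satisfy the same formulas. -/
theorem realize_iff_of_ef (φ : (coloredGraphLang t).BoundedFormula (Fin k) m) {q : ℕ}
    (hq : formulaSize φ ≤ q) {G G' : ColoredGraph.{u} t} {ρ : Set (G.V × G'.V)}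
    (h : EF G.world G'.world q ρ) {v : Fin k → G.V} {v' : Fin k → G'.V} {xs : Fin m → G.V}
    {xs' : Fin m → G'.V} (hv : ∀ a ∈ φ.freeVarFinset, (v a, v' a) ∈ ρ)
    (hx : ∀ i, (xs i, xs' i) ∈ ρ) : φ.Realize v xs ↔ φ.Realize v' xs' := by
  induction φ generalizing q ρ with
  | falsum => exact Iff.rfl
  | equal t₁ t₂ =>
    have h1 := realize_term_mem hx t₁ fun a ha => hv a (Finset.mem_union_left _ ha)
    have h2 := realize_term_mem hx t₂ fun a ha => hv a (Finset.mem_union_right _ ha)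
    exact ((h.partialIso _ h1).2 _ h2).1
  | rel R ts =>
    have h1 : ∀ i, ((ts i).realize (Sum.elim v xs), (ts i).realize (Sum.elim v' xs')) ∈ ρ :=
      fun i => realize_term_mem hx (ts i)
        fun a ha => hv a (Finset.mem_biUnion.2 ⟨i, Finset.mem_univ _, ha⟩)
    cases R with
    | adj => exact ((h.partialIso _ (h1 0)).2 _ (h1 1)).2
    | color c => exact (h.partialIso _ (h1 0)).1 c
  | imp φ ψ ih1 ih2 =>
    simp only [formulaSize] at hq
    have e1 := ih1 (by omega) h (fun a ha => hv a (Finset.mem_union_left _ ha)) hx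
    have e2 := ih2 (by omega) h (fun a ha => hv a (Finset.mem_union_right _ ha)) hx
    rw [FirstOrder.Language.BoundedFormula.realize_imp,
      FirstOrder.Language.BoundedFormula.realize_imp, e1, e2]
  | all φ ih =>
    simp only [formulaSize] at hq
    obtain ⟨q, rfl⟩ : ∃ q', q = q' + 1 := ⟨q - 1, by omega⟩
    rw [FirstOrder.Language.BoundedFormula.realize_all,
      FirstOrder.Language.BoundedFormula.realize_all]
    have key : ∀ c c', EF G.world G'.world q (insert (c, c') ρ) →
        (φ.Realize v (Fin.snoc xs c) ↔ φ.Realize v' (Fin.snoc xs' c')) := by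
      intro c c' h'
      refine ih (by omega) h' (fun a ha => Set.mem_insert_of_mem _ (hv a ha)) fun i => ?_
      refine Fin.lastCases ?_ (fun i => ?_) i
      · simp
      · simpa using Or.inr (hx i)
    constructor
    · intro hall c'
      obtain ⟨c, -, h'⟩ := h.2.2 c' (Set.mem_univ _)
      exact (key c c' h').1 (hall c)
    · intro hall c
      obtain ⟨c', -, h'⟩ := h.2.1 c (Set.mem_univ _)
      exact (key c c' h').2 (hall c')

end realize

/-! ### The collapse of the alternation hierarchy -/

/-- Coloured graphs as structures defined in themselves. -/
def fullQuery (t k : ℕ) : WorldQuery.{u} t (Fin t) (Fin k) where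
  dom := fun _ _ => Set.univ
  col := fun c G _ => G.color c

theorem definable_fullQuery (t k : ℕ) : (fullQuery.{u} t k).Definable 3 := by
  refine ⟨?_, fun c b => (Dfn.color c none).mono le_rfl (by omega)⟩
  exact (Dfn.falsum.imp Dfn.falsum).congr fun G v => by simp [fullQuery]

/-- By the invariance of formulas under the game, the truth values of the type queries decide `φ` on
the class. So `φ` is the disjunction, over the vectors of truth values that occur with `φ` true, of
the conjunctions that describe them. -/
theorem exists_equivalentOn (t d : ℕ) (hd : 1 ≤ d) : ∃ h : ℕ, ∀ (C : Set (ColoredGraph.{u} t))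
    (k x R n : ℕ) (φ : (coloredGraphLang t).Formula (Fin k)), tower h (formulaSize φ) ≤ R →
    formulaSize φ ≤ x → R ≤ x → n ≤ x → t ≤ x →
    (∀ G ∈ C, SplitterWins G.graph R n d Set.univ) →
    ∃ ψ : (coloredGraphLang t).Formula (Fin k), EquivalentOn C φ ψ ∧
      alternationRank ψ ≤ 2 * d ∧ formulaSize ψ ≤ tower h x := by
  classical
  obtain ⟨h₀, hh₀⟩ := exists_hasTypes.{u} t d
  obtain ⟨h, hh⟩ := hh₀.tuple
  have eN : ElementarilyBounded fun x => tower h (x + 3) := .tower_comp h (.add .id (.const 3))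
  obtain ⟨h', hh'⟩ : ElementarilyBounded fun x =>
      2 ^ tower h (x + 3) * (tower h (x + 3) * (tower h (x + 3) + 7) + 3 + 7) + 5 :=
    .add (.mul (.pow (.const 2) eN) (.add (.add (.mul eN (.add eN (.const 7))) (.const 3))
      (.const 7))) (.const 5)
  refine ⟨max h h', fun C k x R n φ htow hq hR hn ht hC => ?_⟩
  -- The distinguished tuple consists of the variables that occur free in `φ`, as their number,
  -- unlike `k`, is bounded by the size. The size also bounds the quantifier rank, hence the number
  -- of rounds.
  obtain ⟨J, hJ, Φ, hcard, hdfn, hdet⟩ := hh (x + 3) (formulaSize φ) R n (Fin t) (Fin k)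
    φ.freeVarFinset (fullQuery t k) (fun a => a) (by omega) (by omega) (by omega)
    (by simp only [Fintype.card_fin]; omega)
    (by have := card_freeVarFinset_le φ; simp only [Fintype.card_coe]; omega)
    ((definable_fullQuery t k).mono (by omega))
    ((tower_le_tower (le_max_left _ _) _).trans htow)
  let A : Set (J → Bool) := {χ | ∃ G ∈ C, ∃ v : Fin k → G.V, φ.Realize v ∧
    ∀ j, (Φ j G v ↔ χ j = true)}
  have hχ : ∀ χ : J → Bool, Dfn true (2 * d) (tower h (x + 3) * (tower h (x + 3) + 7) + 3)
      (fun G v => χ ∈ A ∧ ∀ j, (Φ j G v ↔ χ j = true)) := by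
    intro χ
    by_cases hA : χ ∈ A
    · have h1 := Dfn.all_fintype fun j => ((hdfn j).iff_bool (χ j)).mono
        (show 2 * d - 1 + 1 ≤ 2 * d by omega) le_rfl
      refine (h1.mono le_rfl ?_).congr fun G v => by simp [hA]
      have := Nat.mul_le_mul_right (tower h (x + 3) + 7) hcard
      exact Nat.add_le_add_right this 3
    · exact (Dfn.falsum.mono le_rfl (by omega)).congr fun G v => by simp [hA]
  obtain ⟨ψ, hψ, hsize, hreal⟩ := Dfn.ex_fintype hχ k 0 Sum.inl
  refine ⟨ψ, fun G hG v => ?_, hψ.alternationRank_le, hsize.trans ?_⟩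
  · rw [FirstOrder.Language.Formula.Realize, FirstOrder.Language.Formula.Realize, hreal]
    constructor
    · intro hφ
      exact ⟨fun j => decide (Φ j G v), ⟨G, hG, v, hφ, fun j => by simp⟩, fun j => by simp⟩
    · rintro ⟨χ, ⟨G', hG', v', hφ', hχ'⟩, hχ⟩
      have hef := hdet G' G v' v (fun _ => Set.mem_univ _) (fun _ => Set.mem_univ _)
        ((hC G' hG').mono (Set.subset_univ _)) ((hC G hG).mono (Set.subset_univ _))
        (fun j => (hχ' j).trans (hχ j).symm)
      exact (realize_iff_of_ef φ le_rfl hef (fun a ha => ⟨⟨a, ha⟩, rfl⟩) (fun i => i.elim0)).1 hφ'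
  · refine le_trans ?_ ((hh' x).trans (tower_le_tower (le_max_right _ _) x))
    have h2 : Fintype.card (J → Bool) ≤ 2 ^ tower h (x + 3) := by
      rw [Fintype.card_fun, Fintype.card_bool]
      exact Nat.pow_le_pow_right (by norm_num) hcard
    exact Nat.add_le_add_right (Nat.mul_le_mul_right _ h2) 5

/-- Without vertices, every formula is equivalent to `⊤` or `⊥`. -/
theorem exists_equivalentOn_of_isEmpty {t : ℕ} (C : Set (ColoredGraph.{u} t))
    (hC : ∀ G ∈ C, IsEmpty G.V) {k : ℕ} (φ : (coloredGraphLang t).Formula (Fin k)) :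
    ∃ ψ : (coloredGraphLang t).Formula (Fin k), EquivalentOn C φ ψ ∧
      alternationRank ψ ≤ 0 ∧ formulaSize ψ ≤ 3 := by
  by_cases h : ∃ G ∈ C, ∃ v : Fin k → G.V, φ.Realize v
  · obtain ⟨G', hG', v', hφ⟩ := h
    refine ⟨.imp .falsum .falsum, fun G hG v => iff_of_true ?_ (fun h => h),
      (AltBound.imp (b := true) .falsum .falsum).alternationRank_le, le_rfl⟩
    have h1 := hC G hG
    have h2 := hC G' hG'
    refine (realize_iff_of_ef φ le_rfl (ρ := ∅) (EF.of_dom_empty ?_ ?_ fun p hp => hp.elim)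
      (fun a => (h2.false (v' a)).elim) (fun i => i.elim0)).1 hφ
    · exact Set.eq_empty_of_isEmpty _
    · exact Set.eq_empty_of_isEmpty _
  · refine ⟨.falsum, fun G hG v => iff_of_false (fun hφ => h ⟨G, hG, v, hφ⟩) (fun h => h),
      (AltBound.falsum (b := true)).alternationRank_le, by simp [formulaSize]⟩

/-- The main result, with a bound on the size in terms of the sizes of the excluded trees. -/
theorem exists_equivalentOn_of_excludedTrees {t : ℕ} (C : Set (ColoredGraph.{u} t)) (d : ℕ)
    (F : ℕ → ℕ) (hF : ∀ r : ℕ, ∃ (W : Type) (_ : Finite W) (T : SimpleGraph W) (root : W),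
      IsRootedTreeOfDepth T root (d + 1) ∧ Nat.card W = F r ∧ ¬ InTopMinors C r T) :
    ∃ f : ℕ → ℕ, (ElementarilyBounded F → ElementarilyBounded f) ∧
      ∀ (k : ℕ) (φ : (coloredGraphLang t).Formula (Fin k)),
        ∃ ψ : (coloredGraphLang t).Formula (Fin k),
          EquivalentOn C φ ψ ∧ alternationRank ψ ≤ 3 * d - 1 ∧
            formulaSize ψ ≤ f (formulaSize φ) := by
  have hwin : ∀ R, ∀ G ∈ C,
      SplitterWins G.graph R ((1 + (F R * (R + 3) + 1) * (R + 2)) ^ R) d Set.univ := by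
    intro R G hG
    obtain ⟨W, _, T, root, hT, hcard, hmin⟩ := hF R
    exact splitterWins_of_not_isShallowTopMinor hT (fun h => hmin ⟨G, hG, h⟩) (by rw [hcard])
  rcases Nat.eq_zero_or_pos d with rfl | hd
  · refine ⟨fun _ => 3, fun _ => .const 3, fun k φ => ?_⟩
    exact exists_equivalentOn_of_isEmpty C (fun G hG => ⟨fun a => hwin 0 G hG a (Set.mem_univ a)⟩) φ
  · obtain ⟨h, hh⟩ := exists_equivalentOn.{u} t d hd
    -- The radius `tower h q` is fixed first, from the size of `φ` alone; the excluded tree for that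
    -- radius then determines the batch size. The argument of the outer tower is the sum of all
    -- parameters, an upper bound for each.
    refine ⟨fun q => tower h (q + tower h q + (1 + (F (tower h q) * (tower h q + 3) + 1) *
      (tower h q + 2)) ^ tower h q + t), fun hFe => ?_, fun k φ => ?_⟩
    · have eR : ElementarilyBounded fun q => tower h q := .tower_comp h .id
      exact .tower_comp h (.add (.add (.add .id eR) (.pow (.add (.const 1) (.mul (.add (.mul
        (.comp hFe eR) (.add eR (.const 3))) (.const 1)) (.add eR (.const 2)))) eR)) (.const t))
    · obtain ⟨ψ, h1, h2, h3⟩ := hh C k (formulaSize φ + tower h (formulaSize φ) +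
        (1 + (F (tower h (formulaSize φ)) * (tower h (formulaSize φ) + 3) + 1) *
          (tower h (formulaSize φ) + 2)) ^ tower h (formulaSize φ) + t)
        (tower h (formulaSize φ)) _ φ le_rfl (by omega) (by omega) (by omega) (by omega)
        (hwin (tower h (formulaSize φ)))
      -- Here `2 * d ≤ 3 * d - 1` because `d ≥ 1`.
      exact ⟨ψ, h1, by omega, h3⟩

theorem theorem6p1 {t : ℕ} (C : Set (ColoredGraph.{u} t)) (d : ℕ) :
    (HasTreeRank C d →
      ∀ (k : ℕ) (φ : (coloredGraphLang t).Formula (Fin k)),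
        ∃ ψ : (coloredGraphLang t).Formula (Fin k),
          EquivalentOn C φ ψ ∧ alternationRank ψ ≤ 3 * d - 1) ∧
    (HasElementaryTreeRank C d →
      ∃ f : ℕ → ℕ, ElementarilyBounded f ∧
        ∀ (k : ℕ) (φ : (coloredGraphLang t).Formula (Fin k)),
          ∃ ψ : (coloredGraphLang t).Formula (Fin k),
            EquivalentOn C φ ψ ∧ alternationRank ψ ≤ 3 * d - 1 ∧
              formulaSize ψ ≤ f (formulaSize φ)) := by
  constructor
  · intro h k φ
    have hex : ∀ r : ℕ, ∃ (N : ℕ) (W : Type) (_ : Finite W) (T : SimpleGraph W) (root : W),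
        IsRootedTreeOfDepth T root (d + 1) ∧ Nat.card W = N ∧ ¬ InTopMinors C r T := by
      intro r
      -- If all trees of depth `d + 1` occurred for this `r`, then `d` would not be the greatest.
      by_contra hcon
      push Not at hcon
      have := h.2 ⟨r, fun W _ T root hT => hcon _ W inferInstance T root hT rfl⟩
      omega
    choose F hF using hex
    obtain ⟨f, -, hf⟩ := exists_equivalentOn_of_excludedTrees C d F hF
    obtain ⟨ψ, h1, h2, -⟩ := hf k φ
    exact ⟨ψ, h1, h2⟩
  · rintro ⟨⟨F, hFe, hF⟩, -⟩
    obtain ⟨f, hfe, hf⟩ := exists_equivalentOn_of_excludedTrees C d F hF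
    exact ⟨f, hfe hFe, hf⟩
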